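/- Let $\lambda>0$ and let $$V(x-y,x-z)=\lambda\left(\frac{1}{|x-y|\,|x-z|}+\frac{1}{|y-z|\,|y-x|}+\frac{1}{|z-x|\,|z-y|}\right),\qquad x,y,z\in\mathbb{R}^3 .$$ For every $M$ there is a finite constant $C$, depending only on $\lambda$ and $M$, such that the following holds. Let $J\subseteq\mathbb{R}$ be any interval containing $0$ (for example $J=\mathbb{R}$), and let $\varphi\in C(J;H^1(\mathbb{R}^3;\mathbb{C}))$ be a solution on $J$ of the quintic Hartree equation $$\mathrm{i}\partial_t\varphi_t=-\Delta\varphi_t+\frac12\left(\int_{\mathbb{R}^3\times\mathbb{R}^3} V(x-y,x-z)\,|\varphi_t(y)|^2|\varphi_t(z)|^2\,\mathrm{d}y\,\mathrm{d}z\right)\varphi_t$$ (the equation being understood in $H^{-1}(\mathbb{R}^3)$, i.e. for every $\eta\in H^1(\mathbb{R}^3)$ the function $t\mapsto\langle\eta,\varphi_t\rangle_{L^2}$ is differentiable on $J$ and the equation holds when paired with $\eta$), with initial data satisfying $\|\varphi_0\|_{H^1}\le M$. Then, for all $t\in J$, $$\int_{\mathbb{R}^3\times\mathbb{R}^3\times\mathbb{R}^3}|V(x-y,x-z)|^2\,|\varphi_t(x)|^2|\varphi_t(y)|^2|\varphi_t(z)|^2\,\mathrm{d}x\,\mathrm{d}y\,\mathrm{d}z\le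 C .$$ -/

import Mathlib

open MeasureTheory
open scoped SchwartzMap LineDeriv InnerProductSpace ENNReal NNReal

noncomputable section

/-- Three-dimensional Euclidean space. -/
abbrev R3 : Type := EuclideanSpace ℝ (Fin 3)

/-- The Hilbert space `L²(ℝ³; ℂ)`. -/
abbrev L2R3 : Type := Lp ℂ 2 (volume : Measure R3)

/-- `g = (g₀, g₁, g₂)` is the distributional gradient of `u`: the identities `∂ᵢ u = gᵢ` hold as
tempered distributions. -/
def IsWeakGradient (u : L2R3) (g : Fin 3 → L2R3) : Prop :=
  ∀ i : Fin 3, ∂_{(EuclideanSpace.single i (1 : ℝ) : R3)} (u : 𝓢'(R3, ℂ)) = (g i : 𝓢'(R3, ℂ))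

/-- The Sobolev space `H¹(ℝ³; ℂ)`, realised as the graph of the weak gradient inside
`L² ⊕ (L²)³` (Hilbert sum). The induced norm is the `H¹` norm
`‖u‖² = ‖u‖²_{L²} + ∑ᵢ ‖∂ᵢ u‖²_{L²}`. -/
def H1Graph : Submodule ℂ (WithLp 2 (L2R3 × PiLp 2 (fun _ : Fin 3 => L2R3))) where
  carrier := {p | IsWeakGradient p.fst p.snd}
  add_mem' := by
    intro p q hp hq i
    have h1 := hp i
    have h2 := hq i
    simp only [← Lp.toTemperedDistributionCLM_apply] at h1 h2 ⊢
    simp only [WithLp.add_fst, WithLp.add_snd, PiLp.add_apply, map_add, ← h1, ← h2,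
      LineDeriv.lineDerivOp_add]
  zero_mem' := by
    intro i
    simp only [← Lp.toTemperedDistributionCLM_apply]
    simp only [WithLp.zero_fst, WithLp.zero_snd, PiLp.zero_apply, map_zero,
      LineDeriv.lineDerivOp_zero]
  smul_mem' := by
    intro c p hp i
    have h1 := hp i
    simp only [← Lp.toTemperedDistributionCLM_apply] at h1 ⊢
    simp only [WithLp.smul_fst, WithLp.smul_snd, PiLp.smul_apply, map_smul, ← h1,
      LineDeriv.lineDerivOp_smul]

/-- The type of `H¹` functions. -/
abbrev H1 : Type := H1Graph

/-- The `L²` function underlying an element of `H¹`. -/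
def H1.fn (u : H1) : L2R3 := (u : WithLp 2 (L2R3 × PiLp 2 (fun _ : Fin 3 => L2R3))).fst

/-- The weak gradient `∇u ∈ L²(ℝ³; ℂ)³` of an element of `H¹`. -/
def H1.grad (u : H1) : PiLp 2 (fun _ : Fin 3 => L2R3) :=
  (u : WithLp 2 (L2R3 × PiLp 2 (fun _ : Fin 3 => L2R3))).snd

/-- The Coulomb potential `v(x) = 1 / |x|` (with the irrelevant value `0` at the origin). -/
def coulomb (x : R3) : ℝ := ‖x‖⁻¹

/-- The three-body potential `V`, as a function of `a = x - y` and `b = x - z`; so `b - a = y - z`,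
and `V(x-y, x-z) = lam (v(x-y) v(x-z) + v(y-z) v(y-x) + v(z-x) v(z-y))`. -/
def threeBody (lam : ℝ) (a b : R3) : ℝ :=
  lam * (coulomb a * coulomb b + coulomb (b - a) * coulomb (-a) + coulomb (-b) * coulomb (a - b))

/-- The mean-field potential `x ↦ ∫ V(x-y, x-z) |u(y)|² |u(z)|² dy dz`. -/
def meanField (lam : ℝ) (u : L2R3) (x : R3) : ℝ :=
  ∫ p : R3 × R3, threeBody lam (x - p.1) (x - p.2) * ‖u p.1‖ ^ 2 * ‖u p.2‖ ^ 2

/-- `φ` is a (strong) `H¹` solution on the time interval `J` of the quintic Hartree equation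
`i ∂ₜ φ = -Δ φ + (1/2) (∫ V(x-y, x-z) |φ(y)|² |φ(z)|² dy dz) φ`: it is continuous into `H¹`, and the
equation holds in the dual `H⁻¹`, that is, tested against every `η ∈ H¹`. -/
structure IsQuinticHartreeSolution (lam : ℝ) (J : Set ℝ) (φ : ℝ → H1) : Prop where
  continuousOn : ContinuousOn φ J
  equation : ∀ η : H1, ∀ t ∈ J,
    HasDerivWithinAt (fun s => Complex.I * ⟪η.fn, (φ s).fn⟫_ℂ)
      (⟪η.grad, (φ t).grad⟫_ℂ
        + (1 / 2) * ∫ x, starRingEnd ℂ (η.fn x)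
            * ((meanField lam (φ t).fn x : ℂ) * (φ t).fn x)) J t

end

/-! By Cauchy–Schwarz, |V|² is at most 3·lam² times a sum of three products of two squared Coulomb
factors. Each product is a tree on x, y, z rooted at x, so integrating out y and z, leaves first,
costs two applications of Hardy's inequality `hardy`, and the last integral is the mass. This bounds
the quantity by 9·lam²·‖u‖²·(4‖∇u‖²)² (`lintegral_threeBody_sq_le`). The gradient is bounded
uniformly in time by conservation of mass and energy: the potential energy is a positive multiple of
∫ ρ (ρ ∗ |·|⁻¹)² with ρ = |u|², hence nonnegative, and at time 0 Hardy bounds it in terms of M.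

The delicate point is energy conservation, because φ is differentiable in time only when tested
against H¹, and the chain rule for the energy is not available. `energy_eq_of_weak` argues without
regularising: after adding increments of a suitable primitive, the t-derivative of Im⟨φ(t), φ(t+h)⟩
is minus the error of the trapezoidal rule for the energy between φ(t) and φ(t+h). The rule is exact
on the kinetic part, and on the rest its error is O(‖φ(t+h) − φ(t)‖²) in L² (`H1.energy_trapezoid`).
By the equation, that squared norm is at most K·h·‖φ(t+h) − φ(t)‖ with the H¹ norm on the right,
which is o(h). Dividing by h and letting h → 0 gives conservation. -/

/-! ### Density of Schwartz functions in H¹. -/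

lemma isWeakGradient_toLp (f : 𝓢(R3, ℂ)) :
    IsWeakGradient (f.toLp 2)
      (fun i => (∂_{(EuclideanSpace.single i (1 : ℝ) : R3)} f).toLp 2) := by
  intro i
  rw [Lp.toTemperedDistribution_toLp_eq, Lp.toTemperedDistribution_toLp_eq]
  exact TemperedDistribution.lineDerivOp_toTemperedDistributionCLM_eq (μ := volume) f _

/-- The partial derivatives of a Schwartz function, as a linear map into `(L²)³`. -/
noncomputable def schwartzGradL2 : 𝓢(R3, ℂ) →ₗ[ℂ] PiLp 2 (fun _ : Fin 3 => L2R3) :=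
  (WithLp.linearEquiv 2 ℂ (Fin 3 → L2R3)).symm.toLinearMap ∘ₗ
    LinearMap.pi fun i => (SchwartzMap.toLpCLM ℂ ℂ 2 (volume : Measure R3)).toLinearMap ∘ₗ
      (LineDeriv.lineDerivOpCLM ℂ 𝓢(R3, ℂ) (EuclideanSpace.single i (1 : ℝ) : R3)).toLinearMap

/-- Schwartz functions as elements of `H¹`. -/
noncomputable def schwartzH1 : 𝓢(R3, ℂ) →ₗ[ℂ] H1 :=
  LinearMap.codRestrict H1Graph ((WithLp.linearEquiv 2 ℂ (L2R3 × PiLp 2 _)).symm.toLinearMap ∘ₗ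
    (SchwartzMap.toLpCLM ℂ ℂ 2 (volume : Measure R3)).toLinearMap.prod schwartzGradL2)
    fun f => isWeakGradient_toLp f

lemma schwartzH1_fn (f : 𝓢(R3, ℂ)) : (schwartzH1 f).fn = f.toLp 2 := rfl

lemma schwartzH1_grad (f : 𝓢(R3, ℂ)) (i : Fin 3) :
    (schwartzH1 f).grad i = (∂_{(EuclideanSpace.single i (1 : ℝ) : R3)} f).toLp 2 := rfl

lemma H1.inner_eq (u v : H1) : ⟪u, v⟫_ℂ = ⟪u.fn, v.fn⟫_ℂ + ⟪u.grad, v.grad⟫_ℂ := by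
  rw [Submodule.coe_inner, WithLp.prod_inner_apply]; rfl

lemma H1.norm_sq_eq (u : H1) : ‖u‖ ^ 2 = ‖u.fn‖ ^ 2 + ‖u.grad‖ ^ 2 := by
  rw [Submodule.coe_norm, WithLp.prod_norm_sq_eq_of_L2]; rfl

lemma H1.isWeakGradient (u : H1) (i : Fin 3) :
    ∂_{(EuclideanSpace.single i (1 : ℝ) : R3)} (u.fn : 𝓢'(R3, ℂ)) = (u.grad i : 𝓢'(R3, ℂ)) :=
  u.2 i

-- Distributional differentiation is continuous. The resulting completeness of `H1` lets
-- `denseRange_schwartzH1` test density through an orthogonal complement.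
set_option maxHeartbeats 1000000 in
lemma isClosed_H1Graph : IsClosed (H1Graph : Set (WithLp 2 (L2R3 × PiLp 2 (fun _ : Fin 3 => L2R3)))) := by
  have : (H1Graph : Set (WithLp 2 (L2R3 × PiLp 2 (fun _ : Fin 3 => L2R3)))) =
      ⋂ i : Fin 3, {p | ∂_{(EuclideanSpace.single i (1 : ℝ) : R3)}
        (Lp.toTemperedDistributionCLM ℂ volume 2 p.fst) =
          Lp.toTemperedDistributionCLM ℂ volume 2 (p.snd i)} := by
    ext p
    simp only [Set.mem_iInter]
    rfl
  rw [this]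
  refine isClosed_iInter fun i => isClosed_eq ?_ ?_
  · exact (LineDeriv.continuous_lineDerivOp _).comp
      ((Lp.toTemperedDistributionCLM ℂ volume 2).continuous.comp (by fun_prop))
  · exact (Lp.toTemperedDistributionCLM ℂ volume 2).continuous.comp (by fun_prop)

instance : CompleteSpace H1 := isClosed_H1Graph.completeSpace_coe

/-- Every Schwartz function is `(1 - Δ) h` for a Schwartz function `h`. -/
lemma exists_schwartz_sub_laplacian_eq (ψ : 𝓢(R3, ℂ)) :
    ∃ h : 𝓢(R3, ℂ), h - Laplacian.laplacian h = ψ := by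
  have hg1 : (fun x : R3 => (1 + (2 * Real.pi) ^ 2 * ‖x‖ ^ 2 : ℝ)).HasTemperateGrowth := by
    fun_prop
  have hg2 : (fun x : R3 => ((1 + ‖(2 * Real.pi) • x‖ ^ 2) ^ (-1 : ℝ) : ℝ)).HasTemperateGrowth :=
    (Function.hasTemperateGrowth_one_add_norm_sq_rpow R3 (-1)).comp
      (by fun_prop : (fun x : R3 => (2 * Real.pi) • x).HasTemperateGrowth)
  -- On the Fourier side 1 - Δ multiplies by 1 + |2πξ|²; the witness inverts this symbol.
  refine ⟨SchwartzMap.fourierMultiplierCLM ℂ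
    (fun x : R3 => ((1 + ‖(2 * Real.pi) • x‖ ^ 2) ^ (-1 : ℝ) : ℝ)) ψ, ?_⟩
  generalize hh : SchwartzMap.fourierMultiplierCLM ℂ
    (fun x : R3 => ((1 + ‖(2 * Real.pi) • x‖ ^ 2) ^ (-1 : ℝ) : ℝ)) ψ = h
  have h1 : h - Laplacian.laplacian h = SchwartzMap.fourierMultiplierCLM ℂ
      (fun x : R3 => (1 + (2 * Real.pi) ^ 2 * ‖x‖ ^ 2 : ℝ)) h := by
    have h2 : (fun x : R3 => ‖x‖ ^ 2).HasTemperateGrowth := by fun_prop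
    have h2' : (((2 * Real.pi) ^ 2) • fun x : R3 => ‖x‖ ^ 2).HasTemperateGrowth :=
      (Function.HasTemperateGrowth.const ((2 * Real.pi) ^ 2)).mul h2
    have h3 : (fun x : R3 => (1 + (2 * Real.pi) ^ 2 * ‖x‖ ^ 2 : ℝ)) =
        (fun _ => (1 : ℝ)) + ((2 * Real.pi) ^ 2) • fun x : R3 => ‖x‖ ^ 2 := rfl
    rw [SchwartzMap.laplacian_eq_fourierMultiplierCLM, neg_smul, sub_neg_eq_add, h3,
      SchwartzMap.fourierMultiplierCLM_apply (_ + _),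
      SchwartzMap.smulLeftCLM_add (by fun_prop) h2',
      add_apply, FourierTransform.fourierInv_add,
      ← SchwartzMap.fourierMultiplierCLM_apply, ← SchwartzMap.fourierMultiplierCLM_apply,
      SchwartzMap.fourierMultiplierCLM_smul h2, SchwartzMap.fourierMultiplierCLM_const]
    simp
  rw [h1, ← hh, SchwartzMap.fourierMultiplierCLM_fourierMultiplierCLM_apply hg1 hg2]
  have : ((fun x : R3 => (1 + (2 * Real.pi) ^ 2 * ‖x‖ ^ 2 : ℝ)) *
      fun x : R3 => ((1 + ‖(2 * Real.pi) • x‖ ^ 2) ^ (-1 : ℝ) : ℝ)) = fun _ => (1 : ℝ) := by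
    funext x
    have : 0 < 1 + (2 * Real.pi) ^ 2 * ‖x‖ ^ 2 := by positivity
    simp only [Pi.mul_apply, norm_smul, mul_pow, Real.rpow_neg_one, Real.norm_eq_abs, sq_abs]
    rw [mul_pow] at this
    exact mul_inv_cancel₀ this.ne'
  rw [this, SchwartzMap.fourierMultiplierCLM_const]
  simp

/-- The complex conjugate of a Schwartz function. -/
noncomputable def schwartzConj (f : 𝓢(R3, ℂ)) : 𝓢(R3, ℂ) :=
  SchwartzMap.postcompCLM (𝕜 := ℝ) (Complex.conjCLE : ℂ →L[ℝ] ℂ) f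

lemma lineDerivOp_conj (f : 𝓢(R3, ℂ)) (m : R3) :
    ∂_{m} (schwartzConj f) = schwartzConj (∂_{m} f) := by
  ext x
  rw [SchwartzMap.lineDerivOp_apply_eq_fderiv]
  simp only [schwartzConj, SchwartzMap.postcompCLM_apply, SchwartzMap.lineDerivOp_apply_eq_fderiv]
  have : ((SchwartzMap.postcompCLM (𝕜 := ℝ) (Complex.conjCLE : ℂ →L[ℝ] ℂ) f : 𝓢(R3, ℂ)) : R3 → ℂ) =
      Complex.conjCLE ∘ f := by
    ext x; simp
  rw [this, ContinuousLinearEquiv.comp_fderiv]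
  rfl

/-- The L² inner product is conjugate-linear in its first slot, while distributions pair bilinearly;
conjugating the test function reconciles the two. -/
lemma inner_toLp_conj (f : 𝓢(R3, ℂ)) (v : L2R3) :
    ⟪(schwartzConj f).toLp 2, v⟫_ℂ = (v : 𝓢'(R3, ℂ)) f := by
  rw [Lp.toTemperedDistribution_apply, L2.inner_def]
  refine integral_congr_ae ?_
  filter_upwards [(schwartzConj f).coeFn_toLp 2 volume] with x hx
  rw [hx]
  simp [schwartzConj, mul_comm]

/-- If u is H¹-orthogonal to all Schwartz functions, then u - Δu = 0 as a distribution; since 1 - Δ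
maps onto the Schwartz space, u = 0. -/
lemma denseRange_schwartzH1 : DenseRange schwartzH1 := by
  have : Dense ((LinearMap.range schwartzH1 : Submodule ℂ H1) : Set H1) := by
    refine (Submodule.dense_iff_topologicalClosure_eq_top (R := ℂ) (M := H1)).2
      ((Submodule.topologicalClosure_eq_top_iff (𝕜 := ℂ) (E := H1)).2 ?_)
    rw [Submodule.eq_bot_iff]
    intro u hu
    have h1 : ∀ h : 𝓢(R3, ℂ), (u.fn : 𝓢'(R3, ℂ)) (h - Laplacian.laplacian h) = 0 := by
      intro h
      set f : 𝓢(R3, ℂ) := schwartzConj h with hf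
      have h2 := (Submodule.mem_orthogonal _ _).1 hu (schwartzH1 f) ⟨f, rfl⟩
      rw [H1.inner_eq, PiLp.inner_apply] at h2
      simp only [schwartzH1_fn, schwartzH1_grad, hf, lineDerivOp_conj, inner_toLp_conj] at h2
      have h3 : ∀ i, ((u.grad i : L2R3) : 𝓢'(R3, ℂ)) (∂_{(EuclideanSpace.single i (1 : ℝ) : R3)} h) =
          - (u.fn : 𝓢'(R3, ℂ)) (∂_{(EuclideanSpace.single i (1 : ℝ) : R3)}
            (∂_{(EuclideanSpace.single i (1 : ℝ) : R3)} h)) := by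
        intro i
        rw [← H1.isWeakGradient, TemperedDistribution.lineDerivOp_apply_apply, map_neg]
      simp only [h3] at h2
      rw [SchwartzMap.laplacian_eq_sum (EuclideanSpace.basisFun (Fin 3) ℝ), map_sub, map_sum]
      simpa [sub_eq_add_neg] using h2
    have h2 : (Lp.toTemperedDistributionCLM ℂ volume 2 u.fn) = 0 := by
      ext ψ
      obtain ⟨h, rfl⟩ := exists_schwartz_sub_laplacian_eq ψ
      exact h1 h
    have h3 : ∀ v : L2R3, Lp.toTemperedDistributionCLM ℂ volume 2 v = 0 → v = 0 := by
      intro v hv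
      have : v ∈ (Lp.toTemperedDistributionCLM ℂ (volume : Measure R3) 2).ker := hv
      rwa [Lp.ker_toTemperedDistributionCLM_eq_bot] at this
    have h4 : ∀ i, u.grad i = 0 := by
      intro i
      apply h3
      rw [Lp.toTemperedDistributionCLM_apply, ← H1.isWeakGradient,
        ← Lp.toTemperedDistributionCLM_apply, h2, LineDeriv.lineDerivOp_zero]
    have h5 := H1.norm_sq_eq u
    rw [h3 _ h2, PiLp.norm_sq_eq_of_L2] at h5
    simpa [h4] using h5
  rwa [LinearMap.coe_range] at this

/-! ### Hardy's inequality. -/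

/-- Hardy's inequality comes from testing |f|² against the divergence of the field (x - c)/(|x - c|²
+ ε); this is one summand of that divergence. -/
lemma hasLineDerivAt_coord_mul_inv (c : R3) {ε : ℝ} (hε : 0 < ε) (i : Fin 3) (x : R3) :
    HasLineDerivAt ℝ (fun x : R3 => (x i - c i) * (‖x - c‖ ^ 2 + ε)⁻¹)
      ((‖x - c‖ ^ 2 + ε)⁻¹ - 2 * (x i - c i) ^ 2 * (‖x - c‖ ^ 2 + ε)⁻¹ ^ 2) x
      (EuclideanSpace.single i 1) := by
  set e : R3 := EuclideanSpace.single i 1 with he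
  have hpos : 0 < ‖x - c‖ ^ 2 + ε := by positivity
  have h0 : HasDerivAt (fun t : ℝ => x + t • e - c) e 0 := by
    simpa using (((hasDerivAt_id (0 : ℝ)).smul_const e).const_add x).sub_const c
  have h1 : HasDerivAt (fun t : ℝ => (x + t • e) i - c i) 1 0 := by
    have : (fun t : ℝ => (x + t • e) i - c i) = fun t => x i + t - c i := by
      funext t; simp [he]
    rw [this]
    exact ((hasDerivAt_id (0 : ℝ)).const_add (x i)).sub_const (c i)
  have h2 : HasDerivAt (fun t : ℝ => ‖x + t • e - c‖ ^ 2 + ε) (2 * (x i - c i)) 0 := by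
    have := h0.norm_sq.add_const ε
    simpa [he, EuclideanSpace.inner_single_right] using this
  have h3 := h1.mul (h2.inv (by simpa using hpos.ne'))
  unfold HasLineDerivAt
  convert! h3 using 1
  simp only [Pi.inv_apply, zero_smul, add_zero]
  field_simp
  ring

set_option maxHeartbeats 400000 in
/-- Hardy's inequality for Schwartz functions, with a regularised weight. -/
lemma schwartz_hardy_regularized (f : 𝓢(R3, ℂ)) (c : R3) {ε : ℝ} (hε : 0 < ε) :
    Integrable (fun x => ‖f x‖ ^ 2 * (‖x - c‖ ^ 2 + ε)⁻¹) ∧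
    ∫ x, ‖f x‖ ^ 2 * (‖x - c‖ ^ 2 + ε)⁻¹ ≤
      4 * ∑ i : Fin 3, ∫ x, ‖(∂_{(EuclideanSpace.single i (1 : ℝ) : R3)} f) x‖ ^ 2 := by
  set w : R3 → ℝ := fun x => (‖x - c‖ ^ 2 + ε)⁻¹ with hw
  have hpos : ∀ x : R3, 0 < ‖x - c‖ ^ 2 + ε := fun x => by positivity
  have hwpos : ∀ x, 0 < w x := fun x => inv_pos.2 (hpos x)
  have hwle : ∀ x, w x ≤ ε⁻¹ := fun x => by
    apply inv_anti₀ hε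
    nlinarith [sq_nonneg ‖x - c‖]
  have hwc : Continuous w := Continuous.inv₀ (by fun_prop) fun x => (hpos x).ne'
  have hnw : ∀ x, ‖x - c‖ ^ 2 * w x ^ 2 ≤ w x := fun x => by
    have h1 : (‖x - c‖ ^ 2 + ε) * w x = 1 := mul_inv_cancel₀ (hpos x).ne'
    nlinarith [mul_pos hε (pow_pos (hwpos x) 2)]
  have hcoord : ∀ (i : Fin 3) (x : R3), (x i - c i) ^ 2 ≤ ‖x - c‖ ^ 2 := fun i x => by
    rw [EuclideanSpace.norm_sq_eq]
    have := Finset.single_le_sum (f := fun j => ‖(x - c) j‖ ^ 2)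
      (fun j _ => sq_nonneg _) (Finset.mem_univ i)
    simpa using this
  have hsumc : ∀ x : R3, ∑ i : Fin 3, (x i - c i) ^ 2 = ‖x - c‖ ^ 2 := fun x => by
    rw [EuclideanSpace.norm_sq_eq]; simp
  have hL2 : ∀ g : 𝓢(R3, ℂ), Integrable (fun x => ‖g x‖ ^ 2) := fun g =>
    (memLp_two_iff_integrable_sq_norm (g.continuous.aestronglyMeasurable)).1 (g.memLp 2)
  have hint : ∀ (g : 𝓢(R3, ℂ)) (b : R3 → ℝ), Continuous b → (∃ K, ∀ x, |b x| ≤ K) →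
      Integrable (fun x => ‖g x‖ ^ 2 * b x) := fun g b hb ⟨K, hK⟩ =>
    (hL2 g).mul_bdd hb.aestronglyMeasurable (Filter.Eventually.of_forall hK)
  have hI : Integrable (fun x => ‖f x‖ ^ 2 * w x) :=
    hint f w hwc ⟨ε⁻¹, fun x => by rw [abs_of_pos (hwpos x)]; exact hwle x⟩
  refine ⟨hI, ?_⟩
  -- Integrate by parts, then apply Young's inequality, weighted so that the sum over i leaves half
  -- of ∫ |f|² w on the right. Absorbing that half turns the 2 into the constant 4.
  have key : ∀ i : Fin 3, Integrable (fun x => ‖f x‖ ^ 2 * (w x - 2 * (x i - c i) ^ 2 * w x ^ 2)) ∧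
      Integrable (fun x => ‖f x‖ ^ 2 * ((x i - c i) ^ 2 * w x ^ 2)) ∧
      ∫ x, ‖f x‖ ^ 2 * (w x - 2 * (x i - c i) ^ 2 * w x ^ 2) ≤
      ∫ x, (2⁻¹ * (‖f x‖ ^ 2 * ((x i - c i) ^ 2 * w x ^ 2)) +
        2 * ‖(∂_{(EuclideanSpace.single i (1 : ℝ) : R3)} f) x‖ ^ 2) := by
    intro i
    set e : R3 := EuclideanSpace.single i 1 with he
    have hb2 : ∀ x, (x i - c i) ^ 2 * w x ^ 2 ≤ ε⁻¹ := fun x =>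
      (mul_le_mul_of_nonneg_right (hcoord i x) (sq_nonneg _)).trans ((hnw x).trans (hwle x))
    have hb2' : ∀ x, 0 ≤ (x i - c i) ^ 2 * w x ^ 2 := fun x => by positivity
    have hI2 : Integrable (fun x => ‖f x‖ ^ 2 * ((x i - c i) ^ 2 * w x ^ 2)) :=
      hint f _ (by fun_prop) ⟨ε⁻¹, fun x => by rw [abs_of_nonneg (hb2' x)]; exact hb2 x⟩
    have hI1 : Integrable (fun x => ‖f x‖ ^ 2 * (w x - 2 * (x i - c i) ^ 2 * w x ^ 2)) := by
      have := hI.sub (hI2.const_mul 2)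
      refine this.congr (Filter.Eventually.of_forall fun x => ?_)
      simp only [Pi.sub_apply]; ring
    have hI3 : Integrable (fun x => 2⁻¹ * (‖f x‖ ^ 2 * ((x i - c i) ^ 2 * w x ^ 2)) +
        2 * ‖(∂_{e} f) x‖ ^ 2) := (hI2.const_mul _).add ((hL2 _).const_mul _)
    have hptw : ∀ x, |2 * ⟪f x, (∂_{e} f) x⟫_ℝ * ((x i - c i) * w x)| ≤
        2⁻¹ * (‖f x‖ ^ 2 * ((x i - c i) ^ 2 * w x ^ 2)) + 2 * ‖(∂_{e} f) x‖ ^ 2 := fun x => by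
      have h1 := abs_real_inner_le_norm (f x) ((∂_{e} f) x)
      rw [abs_mul, abs_mul, abs_two]
      have h2 : |(x i - c i) * w x| ^ 2 = (x i - c i) ^ 2 * w x ^ 2 := by rw [sq_abs]; ring
      have h3 := mul_le_mul_of_nonneg_right h1 (abs_nonneg ((x i - c i) * w x))
      rw [← h2]
      nlinarith [sq_nonneg (‖f x‖ * |(x i - c i) * w x| - 2 * ‖(∂_{e} f) x‖)]
    have hI4 : Integrable (fun x => 2 * ⟪f x, (∂_{e} f) x⟫_ℝ * ((x i - c i) * w x)) := by
      refine hI3.mono' (Continuous.aestronglyMeasurable ?_) (Filter.Eventually.of_forall hptw)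
      have := f.continuous
      have := (∂_{e} f).continuous
      fun_prop
    have hI5 : Integrable (fun x => ‖f x‖ ^ 2 * ((x i - c i) * w x)) := by
      refine hint f _ (by fun_prop) ⟨1 + ε⁻¹, fun x => ?_⟩
      have h2 : |(x i - c i) * w x| ^ 2 = (x i - c i) ^ 2 * w x ^ 2 := by rw [sq_abs]; ring
      nlinarith [hb2 x, sq_nonneg (|(x i - c i) * w x| - 1)]
    have hd1 : ∀ x, HasLineDerivAt ℝ (fun x => ‖f x‖ ^ 2) (2 * ⟪f x, (∂_{e} f) x⟫_ℝ) x e := fun x => by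
      have := (f.hasFDerivAt x).norm_sq.hasLineDerivAt e
      rwa [smul_apply, ContinuousLinearMap.comp_apply, innerSL_apply_apply, two_nsmul, ← two_mul,
        ← SchwartzMap.lineDerivOp_apply_eq_fderiv] at this
    have hd2 : ∀ x : R3, HasLineDerivAt ℝ (fun x : R3 => (x i - c i) * w x)
        (w x - 2 * (x i - c i) ^ 2 * w x ^ 2) x e := fun x => by
      exact hasLineDerivAt_coord_mul_inv c hε i x
    refine ⟨hI1, hI2, ?_⟩
    have hibp := integral_bilinear_hasLineDerivAt_right_eq_neg_left_of_integrable
      (μ := (volume : Measure R3)) (B := ContinuousLinearMap.mul ℝ ℝ) (v := e)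
      (f := fun x => ‖f x‖ ^ 2) (g := fun x : R3 => (x i - c i) * w x)
      (f' := fun x => 2 * ⟪f x, (∂_{e} f) x⟫_ℝ)
      (g' := fun x => w x - 2 * (x i - c i) ^ 2 * w x ^ 2)
      (by simpa only [ContinuousLinearMap.mul_apply'] using hI4)
      (by simpa only [ContinuousLinearMap.mul_apply'] using hI1)
      (by simpa only [ContinuousLinearMap.mul_apply'] using hI5)
      (fun x _ => hd1 x) (fun x _ => hd2 x)
    simp only [ContinuousLinearMap.mul_apply'] at hibp
    rw [hibp, ← integral_neg]
    exact integral_mono hI4.neg hI3 fun x => (neg_le_abs _).trans (hptw x)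
  -- In dimension 3 the divergence is 3w - 2|x - c|²w², which is at least w because |x - c|²w² ≤ w.
  have hs1 : ∫ x, ‖f x‖ ^ 2 * w x ≤
      ∑ i : Fin 3, ∫ x, ‖f x‖ ^ 2 * (w x - 2 * (x i - c i) ^ 2 * w x ^ 2) := by
    rw [← integral_finsetSum _ fun i _ => (key i).1]
    refine integral_mono hI (integrable_finsetSum _ fun i _ => (key i).1) fun x => ?_
    simp only
    rw [← Finset.mul_sum, Finset.sum_sub_distrib, ← Finset.sum_mul, ← Finset.mul_sum, hsumc]
    refine mul_le_mul_of_nonneg_left ?_ (sq_nonneg _)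
    simp only [Finset.sum_const, Finset.card_univ, Fintype.card_fin, nsmul_eq_mul]
    push_cast
    nlinarith [hnw x]
  have hs2 : ∑ i : Fin 3, ∫ x, ‖f x‖ ^ 2 * ((x i - c i) ^ 2 * w x ^ 2) ≤
      ∫ x, ‖f x‖ ^ 2 * w x := by
    rw [← integral_finsetSum _ fun i _ => (key i).2.1]
    refine integral_mono (integrable_finsetSum _ fun i _ => (key i).2.1) hI fun x => ?_
    simp only
    rw [← Finset.mul_sum, ← Finset.sum_mul, hsumc]
    exact mul_le_mul_of_nonneg_left (hnw x) (sq_nonneg _)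
  have hs3 := hs1.trans (Finset.sum_le_sum fun i _ => (key i).2.2)
  have hs4 : ∀ i : Fin 3, ∫ x, (2⁻¹ * (‖f x‖ ^ 2 * ((x i - c i) ^ 2 * w x ^ 2)) +
        2 * ‖(∂_{(EuclideanSpace.single i (1 : ℝ) : R3)} f) x‖ ^ 2) =
      2⁻¹ * (∫ x, ‖f x‖ ^ 2 * ((x i - c i) ^ 2 * w x ^ 2)) +
        2 * ∫ x, ‖(∂_{(EuclideanSpace.single i (1 : ℝ) : R3)} f) x‖ ^ 2 := fun i => by
    rw [integral_add ((key i).2.1.const_mul _) ((hL2 _).const_mul _), integral_const_mul,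
      integral_const_mul]
  simp only [hs4] at hs3
  rw [Finset.sum_add_distrib, ← Finset.mul_sum, ← Finset.mul_sum] at hs3
  linarith

lemma norm_toLp_sq_eq_integral (v : L2R3) : ‖v‖ ^ 2 = ∫ x, ‖v x‖ ^ 2 := by
  have := L2.inner_def (𝕜 := ℂ) v v
  rw [inner_self_eq_norm_sq_to_K] at this
  have h2 : ∀ x, ⟪v x, v x⟫_ℂ = ((‖v x‖ ^ 2 : ℝ) : ℂ) := fun x => by
    rw [inner_self_eq_norm_sq_to_K]; simp
  simp only [h2] at this
  rw [integral_complex_ofReal] at this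
  rw [← Complex.ofReal_inj, ← this]
  simp

/-- Hardy's inequality in `H¹`. -/
lemma hardy (u : H1) (c : R3) :
    ∫⁻ x, ENNReal.ofReal (coulomb (c - x) ^ 2 * ‖u.fn x‖ ^ 2) ≤
      ENNReal.ofReal (4 * ‖u.grad‖ ^ 2) := by
  -- Approximate u in H¹, pass to an a.e. convergent subsequence, and let the regularisation 1/(k+1)
  -- vanish along it; Fatou's lemma concludes.
  obtain ⟨f, hf⟩ : ∃ f : ℕ → 𝓢(R3, ℂ), Filter.Tendsto (fun n => schwartzH1 (f n)) Filter.atTop (nhds u) := by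
    obtain ⟨s, hs, hs'⟩ := mem_closure_iff_seq_limit.1 (denseRange_schwartzH1 u)
    choose f hf using hs
    exact ⟨f, by simpa [hf] using hs'⟩
  have hfn : Continuous H1.fn := by
    unfold H1.fn; fun_prop
  have hgrad : Continuous H1.grad := by
    unfold H1.grad; fun_prop
  obtain ⟨n, hn, hae⟩ := (tendstoInMeasure_of_tendsto_Lp
    ((hfn.tendsto u).comp hf)).exists_seq_tendsto_ae
  have hreg : ∀ (k : ℕ), ∫⁻ x, ENNReal.ofReal
      (‖(schwartzH1 (f (n k))).fn x‖ ^ 2 * (‖x - c‖ ^ 2 + 1 / ((k : ℝ) + 1))⁻¹) ≤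
        ENNReal.ofReal (4 * ‖(schwartzH1 (f (n k))).grad‖ ^ 2) := fun k => by
    obtain ⟨h1, h2⟩ := schwartz_hardy_regularized (f (n k)) c (Nat.one_div_pos_of_nat (n := k) (α := ℝ))
    have h3 : (fun x => ENNReal.ofReal (‖(schwartzH1 (f (n k))).fn x‖ ^ 2 *
        (‖x - c‖ ^ 2 + 1 / ((k : ℝ) + 1))⁻¹)) =ᵐ[volume]
        fun x => ENNReal.ofReal (‖f (n k) x‖ ^ 2 * (‖x - c‖ ^ 2 + 1 / ((k : ℝ) + 1))⁻¹) := by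
      filter_upwards [(f (n k)).coeFn_toLp 2 volume] with x hx
      rw [schwartzH1_fn, hx]
    rw [lintegral_congr_ae h3, ← ofReal_integral_eq_lintegral_ofReal h1
      (Filter.Eventually.of_forall fun x => by positivity)]
    refine ENNReal.ofReal_le_ofReal (h2.trans_eq ?_)
    rw [PiLp.norm_sq_eq_of_L2]
    congr 1
    refine Finset.sum_congr rfl fun i _ => ?_
    rw [schwartzH1_grad, norm_toLp_sq_eq_integral]
    refine integral_congr_ae ?_
    filter_upwards [(∂_{(EuclideanSpace.single i (1 : ℝ) : R3)} (f (n k))).coeFn_toLp 2 volume] with x hx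
    rw [hx]
  have hlim : Filter.Tendsto (fun k => ENNReal.ofReal (4 * ‖(schwartzH1 (f (n k))).grad‖ ^ 2))
      Filter.atTop (nhds (ENNReal.ofReal (4 * ‖u.grad‖ ^ 2))) := by
    refine ENNReal.tendsto_ofReal ?_
    exact ((((hgrad.tendsto u).comp (hf.comp hn.tendsto_atTop)).norm).pow 2).const_mul 4
  have hle : ∀ᵐ x, ENNReal.ofReal (coulomb (c - x) ^ 2 * ‖u.fn x‖ ^ 2) ≤
      Filter.liminf (fun k : ℕ => ENNReal.ofReal
      (‖(schwartzH1 (f (n k))).fn x‖ ^ 2 * (‖x - c‖ ^ 2 + 1 / ((k : ℝ) + 1))⁻¹)) Filter.atTop := by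
    filter_upwards [hae] with x hx
    by_cases hxc : x = c
    · simp [hxc, coulomb]
    · refine le_of_eq (Filter.Tendsto.liminf_eq (ENNReal.tendsto_ofReal ?_)).symm
      have h1 : coulomb (c - x) ^ 2 * ‖u.fn x‖ ^ 2 = ‖u.fn x‖ ^ 2 * (‖x - c‖ ^ 2 + 0)⁻¹ := by
        rw [coulomb, norm_sub_rev, add_zero, mul_comm, inv_pow]
      rw [h1]
      refine (hx.norm.pow 2).mul (Filter.Tendsto.inv₀
        (tendsto_one_div_add_atTop_nhds_zero_nat.const_add _) ?_)
      have : 0 < ‖x - c‖ := norm_pos_iff.2 (sub_ne_zero.2 hxc)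
      positivity
  refine (lintegral_mono_ae hle).trans ((lintegral_liminf_le' fun k => ?_).trans ?_)
  · have := (Lp.aestronglyMeasurable (schwartzH1 (f (n k))).fn).aemeasurable
    fun_prop
  · rw [← hlim.liminf_eq]
    exact Filter.liminf_le_liminf (Filter.Eventually.of_forall hreg)

/-! ### Conservation laws for weak Hamiltonian evolutions. -/

section Conservation

open Filter Topology Set

variable {X H : Type*} [NormedAddCommGroup X] [NormedSpace ℂ X] [NormedAddCommGroup H]
  [InnerProductSpace ℂ H] {ι : X →L[ℂ] H} {P : X → X → ℂ} {φ ψ : ℝ → X}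

/-- Product rule for the `H`-inner product of two curves that are continuous in `X` and
differentiable against every test vector in `X`. -/
lemma hasDerivAt_inner_of_weak {t K : ℝ} {φ' ψ' : X → ℂ}
    (hψc : ContinuousAt ψ t)
    (hφ : ∀ η : X, HasDerivAt (fun s => ⟪ι η, ι (φ s)⟫_ℂ) (φ' η) t)
    (hψ : ∀ η : X, HasDerivAt (fun s => ⟪ι η, ι (ψ s)⟫_ℂ) (ψ' η) t)
    (hK : ∀ᶠ s in 𝓝 t, ∀ η : X, ‖⟪ι η, ι (φ s) - ι (φ t)⟫_ℂ‖ ≤ K * ‖η‖ * |s - t|) :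
    HasDerivAt (fun s => ⟪ι (φ s), ι (ψ s)⟫_ℂ)
      (starRingEnd ℂ (φ' (ψ t)) + ψ' (φ t)) t := by
  -- The product of the increments is o(|s - t|): one is Lipschitz when tested against X, the other
  -- tends to 0 in X. This replaces strong differentiability in H.
  have h1 : HasDerivAt (fun s => ⟪ι (φ s) - ι (φ t), ι (ψ s) - ι (ψ t)⟫_ℂ) 0 t := by
    rw [hasDerivAt_iff_isLittleO]
    simp only [sub_self, inner_zero_left, sub_zero, smul_zero]
    have h2 : Tendsto (fun s => K * ‖ψ s - ψ t‖) (𝓝 t) (𝓝 0) := by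
      have : Tendsto (fun s => K * ‖ψ s - ψ t‖) (𝓝 t) (𝓝 (K * ‖ψ t - ψ t‖)) :=
        ((hψc.sub continuousAt_const).norm).const_mul K
      simpa using this
    rw [Asymptotics.isLittleO_iff]
    intro c hc
    filter_upwards [hK, h2.eventually_lt_const hc] with s hs hs2
    have h3 := hs (ψ s - ψ t)
    rw [map_sub, norm_inner_symm] at h3
    exact h3.trans (mul_le_mul_of_nonneg_right hs2.le (abs_nonneg _))
  have h2 : HasDerivAt (fun s => ⟪ι (φ s), ι (ψ t)⟫_ℂ) (starRingEnd ℂ (φ' (ψ t))) t := by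
    have := (hφ (ψ t)).star
    simpa using this
  have h3 := (h1.add h2).add (hψ (φ t))
  have h4 := h3.sub_const ⟪ι (φ t), ι (ψ t)⟫_ℂ
  rw [zero_add] at h4
  refine h4.congr_of_eventuallyEq (Eventually.of_forall fun s => ?_)
  simp only [Pi.add_apply, inner_sub_left, inner_sub_right]
  ring

/-- Curves that are continuous in `X` and satisfy `i ∂ₜ φ = P(·, φ)` weakly are Lipschitz against
every test vector. -/
lemma weak_lipschitz {a b K : ℝ}
    (hK : ∀ η, ∀ t ∈ Icc a b, ‖P η (φ t)‖ ≤ K * ‖η‖)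
    (heq : ∀ η, ∀ t ∈ Icc a b,
      HasDerivWithinAt (fun s => ⟪ι η, ι (φ s)⟫_ℂ) (-Complex.I * P η (φ t)) (Icc a b) t)
    {s t : ℝ} (hs : s ∈ Icc a b) (ht : t ∈ Icc a b) (η : X) :
    ‖⟪ι η, ι (φ s) - ι (φ t)⟫_ℂ‖ ≤ K * ‖η‖ * |s - t| := by
  have := (convex_Icc a b).norm_image_sub_le_of_norm_hasDerivWithin_le (heq η)
    (C := K * ‖η‖) (fun x hx => by simpa using hK η x hx) ht hs
  simpa [inner_sub_right] using this

/-- The shift h = 0 gives conservation of the norm; shifts h > 0 drive the energy argument. -/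
lemma weak_hasDerivAt_inner {a b K : ℝ}
    (hφ : ContinuousOn φ (Icc a b))
    (hK : ∀ η, ∀ t ∈ Icc a b, ‖P η (φ t)‖ ≤ K * ‖η‖)
    (heq : ∀ η, ∀ t ∈ Icc a b,
      HasDerivWithinAt (fun s => ⟪ι η, ι (φ s)⟫_ℂ) (-Complex.I * P η (φ t)) (Icc a b) t)
    {t h : ℝ} (ht : t ∈ Ioo a b) (hth : t + h ∈ Ioo a b) :
    HasDerivAt (fun s => ⟪ι (φ s), ι (φ (s + h))⟫_ℂ)
      (starRingEnd ℂ (-Complex.I * P (φ (t + h)) (φ t)) + -Complex.I * P (φ t) (φ (t + h))) t := by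
  have hd : ∀ η, ∀ t ∈ Ioo a b,
      HasDerivAt (fun s => ⟪ι η, ι (φ s)⟫_ℂ) (-Complex.I * P η (φ t)) t := fun η t ht =>
    (heq η t (Ioo_subset_Icc_self ht)).hasDerivAt (Icc_mem_nhds ht.1 ht.2)
  refine hasDerivAt_inner_of_weak (φ' := fun η => -Complex.I * P η (φ t))
    (ψ := fun s => φ (s + h)) (ψ' := fun η => -Complex.I * P η (φ (t + h))) (K := K)
    ?_ (fun η => hd η t ht) (fun η => (hd η (t + h) hth).comp_add_const t h) ?_
  · have : ContinuousAt φ (t + h) := hφ.continuousAt (Icc_mem_nhds hth.1 hth.2)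
    exact ContinuousAt.comp (f := fun s => s + h) this (by fun_prop)
  · filter_upwards [Icc_mem_nhds ht.1 ht.2] with s hs η
    exact weak_lipschitz hK heq hs (Ioo_subset_Icc_self ht) η

/-- Two-sided derivatives are available only in the interior; continuity carries constancy to the
endpoints. -/
lemma eq_endpoints_of_eq_Ioo {g : ℝ → ℝ} {a b : ℝ} (hab : a < b) (hg : ContinuousOn g (Icc a b))
    (h : ∀ x ∈ Ioo a b, ∀ y ∈ Ioo a b, x < y → g x = g y) : g a = g b := by
  obtain ⟨c, hc⟩ := exists_between hab
  have h1 : EqOn g (fun _ => g c) (Ioo a b) := fun x hx => by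
    rcases lt_trichotomy x c with h2 | h2 | h2
    · exact h x hx c hc h2
    · rw [h2]
    · exact (h c hc x hx h2).symm
  have h2 := h1.of_subset_closure hg continuousOn_const Ioo_subset_Icc_self
    (closure_Ioo hab.ne).ge
  exact (h2 (left_mem_Icc.2 hab.le)).trans (h2 (right_mem_Icc.2 hab.le)).symm

/-- Conservation of the `H`-norm. -/
lemma norm_eq_of_weak {a b K : ℝ} (hab : a < b)
    (hφ : ContinuousOn φ (Icc a b))
    (hK : ∀ η, ∀ t ∈ Icc a b, ‖P η (φ t)‖ ≤ K * ‖η‖)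
    (heq : ∀ η, ∀ t ∈ Icc a b,
      HasDerivWithinAt (fun s => ⟪ι η, ι (φ s)⟫_ℂ) (-Complex.I * P η (φ t)) (Icc a b) t)
    (hreal : ∀ u, (P u u).im = 0) :
    ‖ι (φ a)‖ ^ 2 = ‖ι (φ b)‖ ^ 2 := by
  have hc : ContinuousOn (fun s => ‖ι (φ s)‖ ^ 2) (Icc a b) :=
    ((ι.continuous.comp_continuousOn hφ).norm).pow 2
  refine eq_endpoints_of_eq_Ioo (g := fun s => ‖ι (φ s)‖ ^ 2) hab hc fun x hx y hy hxy => ?_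
  have hd : ∀ t ∈ Ioo a b, HasDerivAt (fun s => ‖ι (φ s)‖ ^ 2) 0 t := by
    intro t ht
    have h1 := weak_hasDerivAt_inner (h := 0) hφ hK heq ht (by simpa using ht)
    simp only [add_zero] at h1
    have h2 := Complex.reCLM.hasFDerivAt.comp_hasDerivAt t h1
    have h3 : (fun s => ‖ι (φ s)‖ ^ 2) = Complex.reCLM ∘ fun s => ⟪ι (φ s), ι (φ s)⟫_ℂ := by
      funext s
      simp only [Function.comp, inner_self_eq_norm_sq_to_K]
      norm_cast
    rw [h3]
    convert! h2 using 1
    simp [hreal]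
  have := (convex_Ioo a b).norm_image_sub_le_of_norm_hasDerivWithin_le
    (fun t ht => (hd t ht).hasDerivWithinAt) (C := 0) (fun _ _ => by simp) hx hy
  simp only [zero_mul, norm_le_zero_iff, sub_eq_zero] at this
  exact this.symm

/-- Conservation of energy for weak solutions of a Hamiltonian evolution equation
`i ∂ₜ φ = P(·, φ)`: it suffices that the trapezoidal rule for the energy along `P` has an error
that is quadratic in the weak norm. -/
lemma energy_eq_of_weak {a b K L : ℝ} {f : X → ℝ} (hab : a < b)
    (hφ : ContinuousOn φ (Icc a b))
    (hK : ∀ η, ∀ t ∈ Icc a b, ‖P η (φ t)‖ ≤ K * ‖η‖)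
    (heq : ∀ η, ∀ t ∈ Icc a b,
      HasDerivWithinAt (fun s => ⟪ι η, ι (φ s)⟫_ℂ) (-Complex.I * P η (φ t)) (Icc a b) t)
    (hsub : ∀ u v w, P (u - v) w = P u w - P v w)
    (hp : ContinuousOn (fun t => (P (φ t) (φ t)).re) (Icc a b))
    (hf : ContinuousOn (fun t => f (φ t)) (Icc a b)) (hK0 : 0 ≤ K) (hL0 : 0 ≤ L)
    (htrap : ∀ s ∈ Icc a b, ∀ t ∈ Icc a b,
      |f (φ t) - f (φ s) - (P (φ t - φ s) (φ s) + P (φ t - φ s) (φ t)).re| ≤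
        L * ‖ι (φ t - φ s)‖ ^ 2) :
    f (φ a) = f (φ b) := by
  refine eq_endpoints_of_eq_Ioo (g := fun s => f (φ s)) hab hf fun x hx y hy hxy => ?_
  -- This primitive serves twice: it cancels Re P(φ, φ) in the derivative of `R t` at t, leaving
  -- only the energy, and it completes the derivative of `Q h` to a trapezoidal error.
  obtain ⟨F, hF⟩ : ∃ F : ℝ → ℝ, ∀ t ∈ Ioo a b,
      HasDerivAt F ((P (φ t) (φ t)).re - f (φ t)) t := by
    refine ⟨fun t => ∫ s in x..t, ((P (φ s) (φ s)).re - f (φ s)), fun t ht => ?_⟩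
    have hc := hp.sub hf
    refine intervalIntegral.integral_hasDerivAt_right ?_ ?_ ?_
    · refine (hc.mono ?_).intervalIntegrable
      exact uIcc_subset_Icc (Ioo_subset_Icc_self hx) (Ioo_subset_Icc_self ht)
    · exact (hc.mono Ioo_subset_Icc_self).stronglyMeasurableAtFilter isOpen_Ioo t ht
    · exact hc.continuousAt (Icc_mem_nhds ht.1 ht.2)
  set R : ℝ → ℝ → ℝ := fun t s => (⟪ι (φ t), ι (φ s)⟫_ℂ).im + F s with hR
  have hRd : ∀ t ∈ Ioo a b, HasDerivAt (R t) (-f (φ t)) t := fun t ht => by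
    have h1 := (heq (φ t) t (Ioo_subset_Icc_self ht)).hasDerivAt (Icc_mem_nhds ht.1 ht.2)
    have h2 := (Complex.imCLM.hasFDerivAt.comp_hasDerivAt t h1).add (hF t ht)
    convert! h2 using 1
    simp only [neg_mul, Complex.imCLM_apply, Complex.neg_im, Complex.mul_im, Complex.I_re,
      Complex.I_im, zero_mul, one_mul, zero_add]
    ring
  set Q : ℝ → ℝ → ℝ := fun h t => (⟪ι (φ t), ι (φ (t + h))⟫_ℂ).im + (F (t + h) - F t) with hQ
  have hQlim : ∀ t ∈ Ioo a b, Tendsto (fun h => h⁻¹ * Q h t) (𝓝[>] 0) (𝓝 (-f (φ t))) :=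
      fun t ht => by
    have h1 := (hasDerivAt_iff_tendsto_slope_zero.1 (hRd t ht)).mono_left
      (nhdsWithin_mono 0 (fun h (hh : 0 < h) => hh.ne'))
    refine h1.congr fun h => ?_
    have h2 : (⟪ι (φ t), ι (φ t)⟫_ℂ).im = 0 := inner_self_im (𝕜 := ℂ) _
    simp only [hR, hQ, smul_eq_mul, h2]
    ring
  have hQd : ∀ h t, t ∈ Ioo a b → t + h ∈ Ioo a b → HasDerivAt (Q h)
      (-(f (φ (t + h)) - f (φ t) -
        (P (φ (t + h) - φ t) (φ t) + P (φ (t + h) - φ t) (φ (t + h))).re)) t := by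
    intro h t ht hth
    have h1 := Complex.imCLM.hasFDerivAt.comp_hasDerivAt t
      (weak_hasDerivAt_inner hφ hK heq ht hth)
    have h2 := h1.add (((hF (t + h) hth).comp_add_const t h).sub (hF t ht))
    convert! h2 using 1
    simp [hsub]
    ring
  have hlim := (hQlim y hy).sub (hQlim x hx)
  -- For small h the derivative of `Q h` is at most L·K·ε·h: the factor h comes from the weak
  -- Lipschitz bound, the factor ε from uniform continuity in X.
  have hest : ∀ ε > 0, |-f (φ y) - -f (φ x)| ≤ L * K * (y - x) * ε := by
    intro ε hε
    have huc := isCompact_Icc.uniformContinuousOn_of_continuous hφ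
    obtain ⟨δ, hδ, hδ'⟩ := Metric.uniformContinuousOn_iff.1 huc ε hε
    refine le_of_tendsto hlim.abs ?_
    have h0 : 0 < min δ (b - y) := lt_min hδ (sub_pos.2 hy.2)
    filter_upwards [Ioo_mem_nhdsGT h0] with h hh
    have hh0 : 0 < h := hh.1
    have hhδ : h < δ := hh.2.trans_le (min_le_left _ _)
    have hhb : h < b - y := hh.2.trans_le (min_le_right _ _)
    have hmem : ∀ t ∈ Icc x y, t ∈ Ioo a b ∧ t + h ∈ Ioo a b := fun t ht =>
      ⟨⟨hx.1.trans_le ht.1, ht.2.trans_lt hy.2⟩,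
        ⟨by linarith [hx.1, ht.1], by linarith [ht.2]⟩⟩
    have := (convex_Icc x y).norm_image_sub_le_of_norm_hasDerivWithin_le (f := Q h)
      (fun t ht => (hQd h t (hmem t ht).1 (hmem t ht).2).hasDerivWithinAt)
      (C := L * (K * ε * h)) (fun t ht => by
        have m1 := Ioo_subset_Icc_self (hmem t ht).1
        have m2 := Ioo_subset_Icc_self (hmem t ht).2
        rw [norm_neg, Real.norm_eq_abs]
        refine (htrap t m1 (t + h) m2).trans (mul_le_mul_of_nonneg_left ?_ hL0)
        -- Testing against the increment itself bounds its squared H-norm.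
        have h1 := weak_lipschitz hK heq m2 m1 (φ (t + h) - φ t)
        have h2 : dist (φ (t + h)) (φ t) < ε := hδ' _ m2 _ m1 (by simpa [abs_of_pos hh0] using hhδ)
        rw [dist_eq_norm] at h2
        rw [← map_sub, inner_self_eq_norm_sq_to_K, add_sub_cancel_left, abs_of_pos hh0] at h1
        have h3 : ‖ι (φ (t + h) - φ t)‖ ^ 2 ≤ K * ‖φ (t + h) - φ t‖ * h := by
          simpa using h1
        refine h3.trans ?_
        gcongr) (left_mem_Icc.2 hxy.le) (right_mem_Icc.2 hxy.le)
    rw [← mul_sub, abs_mul, abs_inv, abs_of_pos hh0, inv_mul_le_iff₀ hh0]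
    rw [Real.norm_eq_abs, Real.norm_eq_abs, abs_of_pos (sub_pos.2 hxy)] at this
    refine this.trans_eq ?_
    ring
  have hz : |-f (φ y) - -f (φ x)| ≤ 0 := by
    have h1 : Tendsto (fun ε : ℝ => L * K * (y - x) * ε) (𝓝[>] 0) (𝓝 0) := by
      have : Tendsto (fun ε : ℝ => L * K * (y - x) * ε) (𝓝 0) (𝓝 (L * K * (y - x) * 0)) :=
        tendsto_id.const_mul _
      rw [mul_zero] at this
      exact this.mono_left nhdsWithin_le_nhds
    refine ge_of_tendsto h1 ?_
    filter_upwards [self_mem_nhdsWithin] with ε hε using hest ε hε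
  have := abs_nonpos_iff.1 hz
  linarith

end Conservation

/-! ### Coulomb potentials of densities. -/

/-- The Cauchy–Schwarz inequality for integrals. -/
lemma integral_mul_le_of_integral_sq_le {α : Type*} [MeasurableSpace α] {μ : Measure α}
    {f g : α → ℝ} (hf : AEStronglyMeasurable f μ) (hg : AEStronglyMeasurable g μ)
    (hf0 : ∀ x, 0 ≤ f x) (hg0 : ∀ x, 0 ≤ g x)
    (hf2 : Integrable (fun x => f x ^ 2) μ) (hg2 : Integrable (fun x => g x ^ 2) μ)
    {a b : ℝ} (ha : 0 ≤ a) (hb : 0 ≤ b)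
    (hfa : ∫ x, f x ^ 2 ∂μ ≤ a ^ 2) (hgb : ∫ x, g x ^ 2 ∂μ ≤ b ^ 2) :
    Integrable (fun x => f x * g x) μ ∧ ∫ x, f x * g x ∂μ ≤ a * b := by
  have hfL : MemLp f 2 μ := (memLp_two_iff_integrable_sq hf).2 hf2
  have hgL : MemLp g 2 μ := (memLp_two_iff_integrable_sq hg).2 hg2
  refine ⟨hfL.integrable_mul hgL, ?_⟩
  have h2 : (2 : ℝ).HolderConjugate 2 := by constructor <;> norm_num
  have := integral_mul_le_Lp_mul_Lq_of_nonneg (μ := μ) h2 (Filter.Eventually.of_forall hf0)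
    (Filter.Eventually.of_forall hg0) (by simpa using hfL) (by simpa using hgL)
  simp only [Real.rpow_two, ← Real.sqrt_eq_rpow] at this
  refine this.trans (mul_le_mul (Real.sqrt_le_iff.2 ⟨ha, hfa⟩) (Real.sqrt_le_iff.2 ⟨hb, hgb⟩)
    (Real.sqrt_nonneg _) ha)

lemma measurable_coulomb : Measurable coulomb := by
  unfold coulomb; fun_prop

lemma coulomb_nonneg (x : R3) : 0 ≤ coulomb x := inv_nonneg.2 (norm_nonneg x)

lemma coulomb_neg (x : R3) : coulomb (-x) = coulomb x := by simp [coulomb]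

lemma coulomb_sub_comm (x y : R3) : coulomb (x - y) = coulomb (y - x) := by
  rw [← neg_sub, coulomb_neg]

/-- The Coulomb potential `f * |·|⁻¹` generated by a density `f`. -/
noncomputable def coulombPot (f : R3 → ℝ) (x : R3) : ℝ := ∫ y, coulomb (x - y) * f y

/-- An integrable density with bounded Coulomb potential. -/
structure CoulombBounded (f : R3 → ℝ) (A B : ℝ) : Prop where
  integrable : Integrable f
  integral_le : ∫ x, |f x| ≤ A
  kernel_integrable : ∀ x, Integrable fun y => coulomb (x - y) * f y
  pot_le : ∀ x, ∫ y, coulomb (x - y) * |f y| ≤ B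

namespace CoulombBounded

variable {f g : R3 → ℝ} {A B A' B' : ℝ}

lemma kernel_integrable_abs (hf : CoulombBounded f A B) (x : R3) :
    Integrable fun y => coulomb (x - y) * |f y| := by
  refine (hf.kernel_integrable x).abs.congr (Filter.Eventually.of_forall fun y => ?_)
  simp only [abs_mul, abs_of_nonneg (coulomb_nonneg _)]

lemma mono (hg : CoulombBounded g A B) (hf : AEStronglyMeasurable f)
    (hfg : ∀ᵐ x, |f x| ≤ g x) : CoulombBounded f A B := by
  have hi : Integrable f := hg.integrable.mono' hf hfg
  have hk : ∀ x, Integrable fun y => coulomb (x - y) * f y := fun x => by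
    refine (hg.kernel_integrable x).mono' ?_ ?_
    · exact (measurable_coulomb.comp (measurable_const.sub measurable_id)).aestronglyMeasurable.mul hf
    · filter_upwards [hfg] with y hy
      rw [norm_mul, Real.norm_eq_abs, Real.norm_eq_abs, abs_of_nonneg (coulomb_nonneg _)]
      exact mul_le_mul_of_nonneg_left hy (coulomb_nonneg _)
  refine ⟨hi, ?_, hk, fun x => ?_⟩
  · refine (integral_mono_ae hi.abs hg.integrable.abs ?_).trans hg.integral_le
    filter_upwards [hfg] with y hy using hy.trans (le_abs_self _)
  · refine le_trans (integral_mono_ae ?_ (hg.kernel_integrable_abs x) ?_) (hg.pot_le x)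
    · refine (hk x).abs.congr (Filter.Eventually.of_forall fun y => ?_)
      simp only [abs_mul, abs_of_nonneg (coulomb_nonneg _)]
    · filter_upwards [hfg] with y hy
      exact mul_le_mul_of_nonneg_left (hy.trans (le_abs_self _)) (coulomb_nonneg _)

lemma add (hf : CoulombBounded f A B) (hg : CoulombBounded g A' B') :
    CoulombBounded (fun x => f x + g x) (A + A') (B + B') := by
  have hk : ∀ x, Integrable fun y => coulomb (x - y) * (f y + g y) := fun x => by
    simp only [mul_add]
    exact (hf.kernel_integrable x).add (hg.kernel_integrable x)
  refine ⟨hf.integrable.add hg.integrable, ?_, hk, fun x => ?_⟩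
  · refine le_trans (integral_mono (hf.integrable.add hg.integrable).abs
      (hf.integrable.abs.add hg.integrable.abs) fun x => abs_add_le _ _) ?_
    simp only [Pi.add_apply]
    rw [integral_add hf.integrable.abs hg.integrable.abs]
    exact add_le_add hf.integral_le hg.integral_le
  · refine le_trans (integral_mono (g := fun y => coulomb (x - y) * |f y| + coulomb (x - y) * |g y|)
      ?_ ((hf.kernel_integrable_abs x).add (hg.kernel_integrable_abs x)) fun y => ?_) ?_
    · refine (hk x).abs.congr (Filter.Eventually.of_forall fun y => ?_)
      simp only [abs_mul, abs_of_nonneg (coulomb_nonneg _)]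
    · simp only [← mul_add]
      exact mul_le_mul_of_nonneg_left (abs_add_le _ _) (coulomb_nonneg _)
    · rw [integral_add (hf.kernel_integrable_abs x) (hg.kernel_integrable_abs x)]
      exact add_le_add (hf.pot_le x) (hg.pot_le x)

lemma const_mul (hf : CoulombBounded f A B) {K : ℝ} (hK : 0 ≤ K) :
    CoulombBounded (fun x => K * f x) (K * A) (K * B) := by
  have hk : ∀ x y, coulomb (x - y) * (K * f y) = K * (coulomb (x - y) * f y) := fun x y => by ring
  have hk' : ∀ x y, coulomb (x - y) * |K * f y| = K * (coulomb (x - y) * |f y|) := fun x y => by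
    rw [abs_mul, abs_of_nonneg hK]; ring
  refine ⟨hf.integrable.const_mul K, ?_, fun x => ?_, fun x => ?_⟩
  · simp only [abs_mul, abs_of_nonneg hK, integral_const_mul]
    exact mul_le_mul_of_nonneg_left hf.integral_le hK
  · simp only [hk]
    exact (hf.kernel_integrable x).const_mul K
  · simp only [hk', integral_const_mul]
    exact mul_le_mul_of_nonneg_left (hf.pot_le x) hK

lemma abs (hf : CoulombBounded f A B) : CoulombBounded (fun x => |f x|) A B :=
  ⟨hf.integrable.abs, by simpa using hf.integral_le, hf.kernel_integrable_abs,
    by simpa using hf.pot_le⟩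

lemma bdd_mul (hf : CoulombBounded f A B) {h : R3 → ℝ} {K : ℝ} (hh : AEStronglyMeasurable h)
    (hK : ∀ x, |h x| ≤ K) : CoulombBounded (fun x => f x * h x) (K * A) (K * B) := by
  have hK0 : 0 ≤ K := (abs_nonneg _).trans (hK 0)
  refine (hf.abs.const_mul hK0).mono (hf.integrable.aestronglyMeasurable.mul hh)
    (Filter.Eventually.of_forall fun x => ?_)
  rw [abs_mul, mul_comm]
  exact mul_le_mul_of_nonneg_right (hK x) (abs_nonneg _)

lemma abs_coulombPot_le (hf : CoulombBounded f A B) (x : R3) : |coulombPot f x| ≤ B := by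
  refine (abs_integral_le_integral_abs).trans (le_trans (le_of_eq ?_) (hf.pot_le x))
  simp only [abs_mul, abs_of_nonneg (coulomb_nonneg _)]

lemma aestronglyMeasurable_kernel (hf : CoulombBounded f A B) :
    AEStronglyMeasurable (fun p : R3 × R3 => coulomb (p.1 - p.2) * f p.2) := by
  refine (measurable_coulomb.comp (measurable_fst.sub measurable_snd)).aestronglyMeasurable.mul ?_
  exact hf.integrable.aestronglyMeasurable.comp_snd

lemma aestronglyMeasurable_coulombPot (hf : CoulombBounded f A B) :
    AEStronglyMeasurable (coulombPot f) :=
  hf.aestronglyMeasurable_kernel.integral_prod_right'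

lemma coulombPot_sub (hf : CoulombBounded f A B) (hg : CoulombBounded g A' B') (x : R3) :
    coulombPot (fun y => f y - g y) x = coulombPot f x - coulombPot g x := by
  simp only [coulombPot, mul_sub]
  exact integral_sub (hf.kernel_integrable x) (hg.kernel_integrable x)

lemma integrable_mul_kernel_mul (hf : CoulombBounded f A B) (hg : CoulombBounded g A' B') :
    Integrable (fun p : R3 × R3 => g p.1 * (coulomb (p.1 - p.2) * f p.2)) := by
  have hm : AEStronglyMeasurable (fun p : R3 × R3 => g p.1 * (coulomb (p.1 - p.2) * f p.2)) :=
    hg.integrable.aestronglyMeasurable.comp_fst.mul hf.aestronglyMeasurable_kernel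
  refine (integrable_prod_iff hm).2 ⟨Filter.Eventually.of_forall fun x =>
    (hf.kernel_integrable x).const_mul (g x), ?_⟩
  have h1 : (fun x => ∫ y, ‖g x * (coulomb (x - y) * f y)‖) =
      fun x => |g x| * coulombPot (fun y => |f y|) x := by
    funext x
    simp only [norm_mul, Real.norm_eq_abs, abs_of_nonneg (coulomb_nonneg _), integral_const_mul]
    rfl
  rw [h1]
  exact (hg.abs.bdd_mul hf.abs.aestronglyMeasurable_coulombPot hf.abs.abs_coulombPot_le).integrable

/-- Fubini and evenness of the Coulomb kernel. -/
lemma integral_mul_coulombPot_comm (hf : CoulombBounded f A B) (hg : CoulombBounded g A' B') :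
    ∫ x, g x * coulombPot f x = ∫ x, f x * coulombPot g x := by
  have h := integral_integral_swap (f := fun x y => g x * (coulomb (x - y) * f y))
    (hf.integrable_mul_kernel_mul hg)
  simp only [integral_const_mul] at h
  refine Eq.trans h ?_
  refine integral_congr_ae (Filter.Eventually.of_forall fun y => ?_)
  simp only [coulombPot]
  rw [← integral_const_mul]
  refine integral_congr_ae (Filter.Eventually.of_forall fun x => ?_)
  simp only [coulomb_sub_comm x y]
  ring

/-- The three-body potential of a density. -/
lemma integral_threeBody (hf : CoulombBounded f A B) (lam : ℝ) (x : R3) :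
    ∫ p : R3 × R3, threeBody lam (x - p.1) (x - p.2) * f p.1 * f p.2 =
      lam * (coulombPot f x ^ 2 + 2 * coulombPot (fun y => f y * coulombPot f y) x) := by
  -- `F1` joins x to both y and z, and `F2` is the chain x–y–z. The third summand of V is the chain
  -- x–z–y, that is, `F2` with y and z swapped.
  set F1 : R3 × R3 → ℝ := fun p => (coulomb (x - p.1) * f p.1) * (coulomb (x - p.2) * f p.2)
  set F2 : R3 × R3 → ℝ := fun p => (coulomb (x - p.1) * f p.1) * (coulomb (p.1 - p.2) * f p.2)
  have hsplit : ∀ p : R3 × R3, threeBody lam (x - p.1) (x - p.2) * f p.1 * f p.2 =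
      lam * (F1 p + (F2 p + F2 p.swap)) := fun p => by
    have h1 : x - p.2 - (x - p.1) = p.1 - p.2 := by abel
    have h2 : x - p.1 - (x - p.2) = p.2 - p.1 := by abel
    simp only [threeBody, F1, F2, coulomb_neg, h1, h2, Prod.fst_swap, Prod.snd_swap]
    ring
  have hi1 : Integrable F1 := (hf.kernel_integrable x).mul_prod (hf.kernel_integrable x)
  have hm2 : AEStronglyMeasurable F2 :=
    (hf.kernel_integrable x).aestronglyMeasurable.comp_fst.mul hf.aestronglyMeasurable_kernel
  have hi2 : Integrable F2 := by
    refine (integrable_prod_iff hm2).2 ⟨Filter.Eventually.of_forall fun y =>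
      (hf.kernel_integrable y).const_mul (coulomb (x - y) * f y), ?_⟩
    have h1 : (fun y => ∫ z, ‖F2 (y, z)‖) =
        fun y => coulomb (x - y) * (|f y| * coulombPot (fun z => |f z|) y) := by
      funext y
      simp only [F2, norm_mul, Real.norm_eq_abs, abs_of_nonneg (coulomb_nonneg _),
        integral_const_mul, mul_assoc]
      rfl
    rw [h1]
    exact (hf.abs.bdd_mul hf.abs.aestronglyMeasurable_coulombPot
      hf.abs.abs_coulombPot_le).kernel_integrable x
  have he1 : ∫ p, F1 p = coulombPot f x ^ 2 := by
    rw [sq]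
    exact integral_prod_mul (fun y => coulomb (x - y) * f y) (fun y => coulomb (x - y) * f y)
  have he2 : ∫ p, F2 p = coulombPot (fun y => f y * coulombPot f y) x := by
    refine (integral_prod _ hi2).trans ?_
    simp only [F2, integral_const_mul, mul_assoc]
    rfl
  have he3 : ∫ p : R3 × R3, F2 p.swap = ∫ p, F2 p := integral_prod_swap F2
  have hi3 : Integrable fun p : R3 × R3 => F2 p.swap := hi2.swap
  have hi4 : Integrable fun p : R3 × R3 => F2 p + F2 p.swap := hi2.add hi3
  simp only [hsplit]
  rw [integral_const_mul, integral_add hi1 hi4, integral_add hi2 hi3, he1, he3, he2]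
  ring

end CoulombBounded

/-- Cauchy–Schwarz with the Coulomb factor placed on v, where Hardy applies. Only the L² norm of u
enters, so taking u to be a difference of two functions needs no control on its gradient. -/
lemma H1.coulombBounded_mul (u v : H1) :
    CoulombBounded (fun x => ‖u.fn x‖ * ‖v.fn x‖) (‖u.fn‖ * ‖v.fn‖)
      (2 * ‖u.fn‖ * ‖v.grad‖) := by
  have hum : AEStronglyMeasurable (fun x => ‖u.fn x‖) := (Lp.aestronglyMeasurable u.fn).norm
  have hvm : AEStronglyMeasurable (fun x => ‖v.fn x‖) := (Lp.aestronglyMeasurable v.fn).norm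
  have hsq : ∀ w : L2R3, Integrable (fun x => ‖w x‖ ^ 2) := fun w =>
    (memLp_two_iff_integrable_sq_norm (Lp.aestronglyMeasurable w)).1 (Lp.memLp w)
  have h1 := integral_mul_le_of_integral_sq_le hum hvm (fun _ => norm_nonneg _)
    (fun _ => norm_nonneg _) (hsq u.fn) (hsq v.fn) (norm_nonneg u.fn) (norm_nonneg v.fn)
    (norm_toLp_sq_eq_integral _).ge (norm_toLp_sq_eq_integral _).ge
  have h2 : ∀ x, Integrable (fun y => ‖u.fn y‖ * (coulomb (x - y) * ‖v.fn y‖)) ∧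
      ∫ y, ‖u.fn y‖ * (coulomb (x - y) * ‖v.fn y‖) ≤ ‖u.fn‖ * (2 * ‖v.grad‖) := fun x => by
    have hm : AEStronglyMeasurable (fun y => coulomb (x - y) * ‖v.fn y‖) :=
      (measurable_coulomb.comp (measurable_const.sub measurable_id)).aestronglyMeasurable.mul hvm
    have hh := hardy v x
    simp only [← mul_pow] at hh
    have hi : Integrable (fun y => (coulomb (x - y) * ‖v.fn y‖) ^ 2) := by
      refine ⟨hm.pow 2, ?_⟩
      rw [hasFiniteIntegral_iff_ofReal (Filter.Eventually.of_forall fun _ => sq_nonneg _)]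
      exact hh.trans_lt ENNReal.ofReal_lt_top
    refine integral_mul_le_of_integral_sq_le hum hm (fun _ => norm_nonneg _)
      (fun _ => mul_nonneg (coulomb_nonneg _) (norm_nonneg _)) (hsq u.fn) hi (norm_nonneg u.fn)
      (by positivity) (norm_toLp_sq_eq_integral _).ge ?_
    rw [← ofReal_integral_eq_lintegral_ofReal hi (Filter.Eventually.of_forall fun _ => sq_nonneg _),
      ENNReal.ofReal_le_ofReal_iff (by positivity)] at hh
    linarith
  have h3 : ∀ x y, coulomb (x - y) * (‖u.fn y‖ * ‖v.fn y‖) =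
      ‖u.fn y‖ * (coulomb (x - y) * ‖v.fn y‖) := fun x y => by ring
  refine ⟨h1.1, ?_, fun x => ?_, fun x => ?_⟩
  · simpa only [abs_mul, abs_norm] using h1.2
  · simpa only [h3] using (h2 x).1
  · simp only [abs_mul, abs_norm, h3]
    exact (h2 x).2.trans_eq (by ring)

namespace CoulombBounded

variable {f g : R3 → ℝ} {A B A' B' : ℝ}

lemma mul_coulombPot (hf : CoulombBounded f A B) (hg : CoulombBounded g A' B') :
    CoulombBounded (fun x => f x * coulombPot g x) (B' * A) (B' * B) :=
  hf.bdd_mul hg.aestronglyMeasurable_coulombPot hg.abs_coulombPot_le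

lemma abs_integral_mul_le (hf : CoulombBounded f A B) {h : R3 → ℝ} {K : ℝ}
    (hK : ∀ x, |h x| ≤ K) : |∫ x, f x * h x| ≤ K * A := by
  have hK0 : 0 ≤ K := (abs_nonneg _).trans (hK 0)
  rw [← Real.norm_eq_abs]
  refine (norm_integral_le_of_norm_le (hf.integrable.abs.const_mul K)
    (Filter.Eventually.of_forall fun x => ?_)).trans ?_
  · rw [norm_mul, mul_comm, Real.norm_eq_abs, Real.norm_eq_abs]
    exact mul_le_mul_of_nonneg_right (hK x) (abs_nonneg _)
  · rw [integral_const_mul]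
    exact mul_le_mul_of_nonneg_left hf.integral_le hK0

lemma abs_three_body_le (hf : CoulombBounded f A B) {lam : ℝ} (hlam : 0 ≤ lam) (x : R3) :
    |lam * (coulombPot f x ^ 2 + 2 * coulombPot (fun y => f y * coulombPot f y) x)| ≤
      3 * lam * B ^ 2 := by
  have h1 := hf.abs_coulombPot_le x
  have h2 := (hf.mul_coulombPot hf).abs_coulombPot_le x
  have h3 : |coulombPot f x ^ 2| ≤ B ^ 2 := by
    rw [abs_pow]; exact pow_le_pow_left₀ (abs_nonneg _) h1 2
  rw [abs_mul, abs_of_nonneg hlam]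
  have h4 : |coulombPot f x ^ 2 + 2 * coulombPot (fun y => f y * coulombPot f y) x| ≤
      3 * B ^ 2 := by
    refine (abs_add_le _ _).trans ?_
    rw [abs_mul, abs_two]
    nlinarith
  nlinarith [mul_le_mul_of_nonneg_left h4 hlam]

/-- Testing the three-body potential of `f` against another density. -/
lemma integral_mul_three_body (hf : CoulombBounded f A B) (hg : CoulombBounded g A' B') (lam : ℝ) :
    ∫ x, g x * (lam * (coulombPot f x ^ 2 + 2 * coulombPot (fun y => f y * coulombPot f y) x)) =
      lam * ((∫ x, g x * coulombPot f x * coulombPot f x) +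
        2 * ∫ x, f x * coulombPot f x * coulombPot g x) := by
  have hff := hf.mul_coulombPot hf
  have h1 : ∀ x, g x * (lam * (coulombPot f x ^ 2 +
      2 * coulombPot (fun y => f y * coulombPot f y) x)) =
      lam * (g x * coulombPot f x * coulombPot f x +
        2 * (g x * coulombPot (fun y => f y * coulombPot f y) x)) := fun x => by ring
  simp only [h1]
  rw [integral_const_mul, integral_add ((hg.mul_coulombPot hf).mul_coulombPot hf).integrable
    ((hg.mul_coulombPot hff).integrable.const_mul 2), integral_const_mul,
    hff.integral_mul_coulombPot_comm hg]

/-- The error of the trapezoidal rule for the cubic functional `f ↦ ∫ f (f * |·|⁻¹)²`. -/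
lemma trapezoid_cubic (hf : CoulombBounded f A B) (hg : CoulombBounded g A' B')
    {s : R3 → ℝ} {A'' B'' : ℝ} (hs : CoulombBounded s A'' B'') (hsfg : ∀ x, s x = g x - f x) :
    2 * ((∫ x, g x * coulombPot g x * coulombPot g x) -
        ∫ x, f x * coulombPot f x * coulombPot f x) -
      (((∫ x, s x * coulombPot f x * coulombPot f x) +
        2 * ∫ x, f x * coulombPot f x * coulombPot s x) +
      ((∫ x, s x * coulombPot g x * coulombPot g x) +
        2 * ∫ x, g x * coulombPot g x * coulombPot s x)) =
    -∫ x, s x * coulombPot s x * coulombPot s x := by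
  -- As for t³ on [0, 1], where 1 - 3/2 = -1/2, the error for a homogeneous cubic is -1/2 of its
  -- value at the increment; the leading factor 2 clears the half. The identity follows by expanding
  -- in f and g.
  have hp : ∀ x, coulombPot s x = coulombPot g x - coulombPot f x := fun x => by
    rw [← hg.coulombPot_sub hf]
    congr 1
    funext y
    exact hsfg y
  have ifff := ((hf.mul_coulombPot hf).mul_coulombPot hf).integrable
  have iffg := ((hf.mul_coulombPot hf).mul_coulombPot hg).integrable
  have ifgg := ((hf.mul_coulombPot hg).mul_coulombPot hg).integrable
  have igff := ((hg.mul_coulombPot hf).mul_coulombPot hf).integrable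
  have iggf := ((hg.mul_coulombPot hg).mul_coulombPot hf).integrable
  have iggg := ((hg.mul_coulombPot hg).mul_coulombPot hg).integrable
  have e1 : ∫ x, s x * coulombPot f x * coulombPot f x =
      (∫ x, g x * coulombPot f x * coulombPot f x) -
        ∫ x, f x * coulombPot f x * coulombPot f x := by
    rw [← integral_sub igff ifff]
    exact integral_congr_ae (Filter.Eventually.of_forall fun x => by simp only [hsfg]; ring)
  have e2 : ∫ x, f x * coulombPot f x * coulombPot s x =
      (∫ x, f x * coulombPot f x * coulombPot g x) -
        ∫ x, f x * coulombPot f x * coulombPot f x := by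
    rw [← integral_sub iffg ifff]
    exact integral_congr_ae (Filter.Eventually.of_forall fun x => by simp only [hp]; ring)
  have e3 : ∫ x, s x * coulombPot g x * coulombPot g x =
      (∫ x, g x * coulombPot g x * coulombPot g x) -
        ∫ x, f x * coulombPot g x * coulombPot g x := by
    rw [← integral_sub iggg ifgg]
    exact integral_congr_ae (Filter.Eventually.of_forall fun x => by simp only [hsfg]; ring)
  have e4 : ∫ x, g x * coulombPot g x * coulombPot s x =
      (∫ x, g x * coulombPot g x * coulombPot g x) -
        ∫ x, g x * coulombPot g x * coulombPot f x := by
    rw [← integral_sub iggg iggf]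
    exact integral_congr_ae (Filter.Eventually.of_forall fun x => by simp only [hp]; ring)
  have e5 : ∫ x, s x * coulombPot s x * coulombPot s x =
      ((∫ x, s x * coulombPot f x * coulombPot f x) +
        ∫ x, s x * coulombPot g x * coulombPot g x) -
      2 * ((∫ x, g x * coulombPot g x * coulombPot f x) -
        ∫ x, f x * coulombPot f x * coulombPot g x) := by
    have i1 := ((hs.mul_coulombPot hf).mul_coulombPot hf).integrable
    have i2 := ((hs.mul_coulombPot hg).mul_coulombPot hg).integrable
    have i3 : Integrable fun x => s x * coulombPot f x * coulombPot f x +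
        s x * coulombPot g x * coulombPot g x := i1.add i2
    have i4 : Integrable fun x => 2 * (g x * coulombPot g x * coulombPot f x -
        f x * coulombPot f x * coulombPot g x) := (iggf.sub iffg).const_mul 2
    rw [← integral_add i1 i2, ← integral_sub iggf iffg, ← integral_const_mul,
      ← integral_sub i3 i4]
    refine integral_congr_ae (Filter.Eventually.of_forall fun x => ?_)
    simp only [hp, hsfg]
    ring
  rw [e5, e1, e2, e3, e4]
  ring

end CoulombBounded

/-! ### The nonlinearity, the energy and its trapezoidal rule. -/

namespace H1

lemma norm_fn_le (u : H1) : ‖u.fn‖ ≤ ‖u‖ := by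
  have := u.norm_sq_eq
  nlinarith [norm_nonneg u, norm_nonneg u.fn, sq_nonneg ‖u.grad‖]

lemma norm_grad_le (u : H1) : ‖u.grad‖ ≤ ‖u‖ := by
  have := u.norm_sq_eq
  nlinarith [norm_nonneg u, norm_nonneg u.grad, sq_nonneg ‖u.fn‖]

lemma sub_fn (u v : H1) : (u - v).fn = u.fn - v.fn := rfl

lemma sub_grad (u v : H1) : (u - v).grad = u.grad - v.grad := rfl

/-- The inclusion `H¹ → L²`. -/
noncomputable def fnCLM : H1 →L[ℂ] L2R3 :=
  LinearMap.mkContinuous { toFun := fn, map_add' := fun _ _ => rfl, map_smul' := fun _ _ => rfl } 1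
    fun u => by rw [one_mul]; exact u.norm_fn_le

@[simp] lemma fnCLM_apply (u : H1) : fnCLM u = u.fn := rfl

lemma continuous_grad : Continuous grad := by
  unfold grad; fun_prop

lemma coulombBounded_density (u : H1) :
    CoulombBounded (fun x => ‖u.fn x‖ ^ 2) (‖u.fn‖ ^ 2) (2 * ‖u.fn‖ * ‖u.grad‖) := by
  simpa only [sq] using u.coulombBounded_mul u

lemma meanField_eq (lam : ℝ) (u : H1) (x : R3) :
    meanField lam u.fn x = lam * (coulombPot (fun y => ‖u.fn y‖ ^ 2) x ^ 2 +
      2 * coulombPot (fun y => ‖u.fn y‖ ^ 2 * coulombPot (fun y => ‖u.fn y‖ ^ 2) y) x) :=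
  u.coulombBounded_density.integral_threeBody lam x

lemma abs_meanField_le {lam : ℝ} (hlam : 0 ≤ lam) (u : H1) (x : R3) :
    |meanField lam u.fn x| ≤ 3 * lam * (2 * ‖u.fn‖ * ‖u.grad‖) ^ 2 := by
  rw [meanField_eq]
  exact u.coulombBounded_density.abs_three_body_le hlam x

lemma abs_meanField_le_of_norm_le {lam : ℝ} (hlam : 0 ≤ lam) (u : H1) {R : ℝ} (hu : ‖u‖ ≤ R)
    (x : R3) : |meanField lam u.fn x| ≤ 12 * lam * R ^ 4 := by
  refine (abs_meanField_le hlam u x).trans ?_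
  have hR : 0 ≤ R := (norm_nonneg u).trans hu
  have h1 : 2 * ‖u.fn‖ * ‖u.grad‖ ≤ 2 * R * R := by
    gcongr
    · exact u.norm_fn_le.trans hu
    · exact u.norm_grad_le.trans hu
  calc 3 * lam * (2 * ‖u.fn‖ * ‖u.grad‖) ^ 2 ≤ 3 * lam * (2 * R * R) ^ 2 := by gcongr
    _ = 12 * lam * R ^ 4 := by ring

lemma aestronglyMeasurable_meanField (lam : ℝ) (u : H1) :
    AEStronglyMeasurable (meanField lam u.fn) := by
  have h1 := u.coulombBounded_density
  have : meanField lam u.fn = _ := funext (meanField_eq lam u)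
  rw [this]
  exact ((h1.aestronglyMeasurable_coulombPot.pow 2).add
    ((h1.mul_coulombPot h1).aestronglyMeasurable_coulombPot.const_mul 2)).const_mul lam

lemma memLp_nonlinearity {lam : ℝ} (hlam : 0 ≤ lam) (u : H1) :
    MemLp (fun x => (meanField lam u.fn x : ℂ) * u.fn x) 2 := by
  refine MemLp.of_le_mul (c := 3 * lam * (2 * ‖u.fn‖ * ‖u.grad‖) ^ 2) (Lp.memLp u.fn)
    ((Complex.continuous_ofReal.comp_aestronglyMeasurable
      (u.aestronglyMeasurable_meanField lam)).mul (Lp.aestronglyMeasurable u.fn))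
    (Filter.Eventually.of_forall fun x => ?_)
  rw [norm_mul, Complex.norm_real]
  exact mul_le_mul_of_nonneg_right (abs_meanField_le hlam u x) (norm_nonneg _)

/-- The nonlinear term of the quintic Hartree equation (without the factor `1/2`), as an element of
`L²`. -/
noncomputable def nonlinearity {lam : ℝ} (hlam : 0 ≤ lam) (u : H1) : L2R3 :=
  (memLp_nonlinearity hlam u).toLp

lemma inner_nonlinearity {lam : ℝ} (hlam : 0 ≤ lam) (v : L2R3) (u : H1) :
    ⟪v, u.nonlinearity hlam⟫_ℂ =
      ∫ x, starRingEnd ℂ (v x) * ((meanField lam u.fn x : ℂ) * u.fn x) := by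
  rw [L2.inner_def]
  refine integral_congr_ae ?_
  filter_upwards [(memLp_nonlinearity hlam u).coeFn_toLp] with x hx
  rw [nonlinearity, hx]
  simp [mul_comm]

lemma norm_nonlinearity_le {lam : ℝ} (hlam : 0 ≤ lam) (u : H1) {R : ℝ} (hu : ‖u‖ ≤ R) :
    ‖u.nonlinearity hlam‖ ≤ 12 * lam * R ^ 4 * ‖u.fn‖ := by
  refine Lp.norm_le_mul_norm_of_ae_le_mul ?_
  filter_upwards [(memLp_nonlinearity hlam u).coeFn_toLp] with x hx
  rw [nonlinearity, hx, norm_mul, Complex.norm_real]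
  exact mul_le_mul_of_nonneg_right (abs_meanField_le_of_norm_le hlam u hu x) (norm_nonneg _)

/-- The right-hand side `-Δ u + (1/2) W[u] u` of the quintic Hartree equation, paired with `η`. -/
noncomputable def rhs {lam : ℝ} (hlam : 0 ≤ lam) (η u : H1) : ℂ :=
  ⟪η.grad, u.grad⟫_ℂ + 1 / 2 * ⟪η.fn, u.nonlinearity hlam⟫_ℂ

lemma rhs_sub {lam : ℝ} (hlam : 0 ≤ lam) (u v w : H1) :
    rhs hlam (u - v) w = rhs hlam u w - rhs hlam v w := by
  simp only [rhs, sub_fn, sub_grad, inner_sub_left]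
  ring

lemma norm_rhs_le {lam : ℝ} (hlam : 0 ≤ lam) (η u : H1) {R : ℝ} (hu : ‖u‖ ≤ R) :
    ‖rhs hlam η u‖ ≤ (R + 6 * lam * R ^ 5) * ‖η‖ := by
  have hR : 0 ≤ R := (norm_nonneg u).trans hu
  have h1 : ‖⟪η.grad, u.grad⟫_ℂ‖ ≤ ‖η‖ * R :=
    (norm_inner_le_norm _ _).trans (mul_le_mul η.norm_grad_le (u.norm_grad_le.trans hu)
      (norm_nonneg _) (norm_nonneg _))
  have h2 : ‖⟪η.fn, u.nonlinearity hlam⟫_ℂ‖ ≤ ‖η‖ * (12 * lam * R ^ 4 * R) :=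
    (norm_inner_le_norm _ _).trans (mul_le_mul η.norm_fn_le
      ((norm_nonlinearity_le hlam u hu).trans (mul_le_mul_of_nonneg_left
        (u.norm_fn_le.trans hu) (by positivity))) (norm_nonneg _) (norm_nonneg _))
  refine (norm_add_le _ _).trans ?_
  have h3 : ‖(1 / 2 : ℂ) * ⟪η.fn, u.nonlinearity hlam⟫_ℂ‖ =
      1 / 2 * ‖⟪η.fn, u.nonlinearity hlam⟫_ℂ‖ := by
    rw [norm_mul]; norm_num
  rw [h3]
  linarith

lemma inner_fn_nonlinearity_self {lam : ℝ} (hlam : 0 ≤ lam) (u : H1) :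
    ⟪u.fn, u.nonlinearity hlam⟫_ℂ = ((∫ x, ‖u.fn x‖ ^ 2 * meanField lam u.fn x : ℝ) : ℂ) := by
  rw [inner_nonlinearity, ← integral_complex_ofReal]
  refine integral_congr_ae (Filter.Eventually.of_forall fun x => ?_)
  simp only
  push_cast
  rw [← Complex.conj_mul']
  ring

/-- The mean-field potential is real; this is what conserves mass. -/
lemma rhs_self_im {lam : ℝ} (hlam : 0 ≤ lam) (u : H1) : (rhs hlam u u).im = 0 := by
  rw [rhs, inner_fn_nonlinearity_self, inner_self_eq_norm_sq_to_K]
  have : (1 / 2 : ℂ) = ((1 / 2 : ℝ) : ℂ) := by norm_num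
  rw [this, Complex.add_im, ← Complex.ofReal_mul, Complex.ofReal_im]
  norm_cast
  rw [add_zero]
  exact Complex.ofReal_im _

/-- The cubic functional of the density in the energy. -/
noncomputable def cubic (u : H1) : ℝ :=
  ∫ x, ‖u.fn x‖ ^ 2 * coulombPot (fun y => ‖u.fn y‖ ^ 2) x * coulombPot (fun y => ‖u.fn y‖ ^ 2) x

/-- The conserved energy of the quintic Hartree equation. -/
noncomputable def energy (lam : ℝ) (u : H1) : ℝ := ‖u.grad‖ ^ 2 + lam / 2 * u.cubic

/-- The potential energy is cubic in the density, so the potential term of the pairing is three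
times it. In this form, continuity in time reduces to continuity of the energy and of the gradient.
-/
lemma rhs_self_re {lam : ℝ} (hlam : 0 ≤ lam) (u : H1) :
    (rhs hlam u u).re = 3 * energy lam u - 2 * ‖u.grad‖ ^ 2 := by
  have h1 := u.coulombBounded_density
  have h2 : ∫ x, ‖u.fn x‖ ^ 2 * meanField lam u.fn x = 3 * lam * u.cubic := by
    simp only [meanField_eq]
    rw [h1.integral_mul_three_body h1, cubic]
    ring
  rw [rhs, inner_fn_nonlinearity_self, inner_self_eq_norm_sq_to_K, h2, energy]
  have : (1 / 2 : ℂ) = ((1 / 2 : ℝ) : ℂ) := by norm_num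
  rw [this, Complex.add_re, ← Complex.ofReal_mul, Complex.ofReal_re]
  have h3 : (((‖u.grad‖ : ℝ) : ℂ) ^ 2).re = ‖u.grad‖ ^ 2 := by
    rw [← Complex.ofReal_pow, Complex.ofReal_re]
  refine (congrArg (· + _) h3).trans ?_
  ring

lemma cubic_nonneg (u : H1) : 0 ≤ u.cubic := by
  refine integral_nonneg fun x => ?_
  simp only [mul_assoc]
  exact mul_nonneg (sq_nonneg _) (mul_self_nonneg _)

lemma cubic_le (u : H1) : u.cubic ≤ (2 * ‖u.fn‖ * ‖u.grad‖) ^ 2 * ‖u.fn‖ ^ 2 := by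
  have h1 := u.coulombBounded_density
  have h2 := h1.abs_integral_mul_le
    (h := fun x => coulombPot (fun y => ‖u.fn y‖ ^ 2) x * coulombPot (fun y => ‖u.fn y‖ ^ 2) x)
    (K := (2 * ‖u.fn‖ * ‖u.grad‖) ^ 2) fun x => by
      rw [abs_mul, ← sq]
      exact pow_le_pow_left₀ (abs_nonneg _) (h1.abs_coulombPot_le x) 2
  simp only [← mul_assoc] at h2
  exact (le_abs_self _).trans h2

/-- The hypothesis `hu` is the polarisation identity, which holds with ε = -1 for u = a and ε = 1
for u = b, so both ends of the trapezoidal rule are covered. -/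
lemma two_mul_re_inner_nonlinearity {lam : ℝ} (hlam : 0 ≤ lam) (a b u : H1) (ε : ℝ)
    (hu : ∀ x, 2 * (starRingEnd ℂ (b.fn x - a.fn x) * u.fn x).re =
      ‖b.fn x‖ ^ 2 - ‖a.fn x‖ ^ 2 + ε * ‖b.fn x - a.fn x‖ ^ 2) :
    2 * (⟪(b - a).fn, u.nonlinearity hlam⟫_ℂ).re =
      (∫ x, (‖b.fn x‖ ^ 2 - ‖a.fn x‖ ^ 2) * meanField lam u.fn x) +
        ε * ∫ x, ‖(b - a).fn x‖ ^ 2 * meanField lam u.fn x := by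
  have hW := u.aestronglyMeasurable_meanField lam
  have hWb := abs_meanField_le hlam u
  have i1 := ((b.coulombBounded_density.bdd_mul hW hWb).integrable)
  have i2 := ((a.coulombBounded_density.bdd_mul hW hWb).integrable)
  have i3 := (((b - a).coulombBounded_density.bdd_mul hW hWb).integrable)
  have i4 : Integrable fun x => (‖b.fn x‖ ^ 2 - ‖a.fn x‖ ^ 2) * meanField lam u.fn x := by
    simp only [sub_mul]
    exact i1.sub i2
  have i5 : Integrable fun x =>
      ⟪(b - a).fn x, u.nonlinearity hlam x⟫_ℂ := L2.integrable_inner _ _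
  rw [← integral_const_mul, ← integral_add i4 (i3.const_mul ε), L2.inner_def]
  have := (Complex.reCLM.integral_comp_comm i5)
  rw [Complex.reCLM_apply] at this
  rw [← this, ← integral_const_mul]
  refine integral_congr_ae ?_
  filter_upwards [(memLp_nonlinearity hlam u).coeFn_toLp, Lp.coeFn_sub b.fn a.fn] with x hx hx2
  have h1 := hu x
  rw [sub_fn, hx2, nonlinearity, hx, Complex.reCLM_apply]
  simp only [Pi.sub_apply]
  have h2 : ⟪b.fn x - a.fn x, (meanField lam u.fn x : ℂ) * u.fn x⟫_ℂ =
      (meanField lam u.fn x : ℂ) * (starRingEnd ℂ (b.fn x - a.fn x) * u.fn x) := by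
    simp only [RCLike.inner_apply]
    ring
  rw [h2, Complex.re_ofReal_mul]
  linear_combination (meanField lam u.fn x) * h1

/-- The trapezoidal rule for the energy has an error that is quadratic in the `L²` norm. -/
lemma energy_trapezoid {lam : ℝ} (hlam : 0 ≤ lam) (a b : H1) {R : ℝ} (ha : ‖a‖ ≤ R)
    (hb : ‖b‖ ≤ R) :
    |energy lam b - energy lam a - (rhs hlam (b - a) a + rhs hlam (b - a) b).re| ≤
      22 * lam * R ^ 4 * ‖(b - a).fn‖ ^ 2 := by
  have hR : 0 ≤ R := (norm_nonneg a).trans ha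
  set d := ‖(b - a).fn‖ with hd
  have hd0 : 0 ≤ d := norm_nonneg _
  have hd2 : d ≤ 2 * R := by
    rw [hd, sub_fn]
    linarith [norm_sub_le b.fn a.fn, a.norm_fn_le, b.norm_fn_le]
  have ea := two_mul_re_inner_nonlinearity hlam a b a (-1) fun x => by
    simp only [Complex.sq_norm, Complex.normSq_apply, Complex.mul_re, Complex.conj_re,
      Complex.conj_im, Complex.sub_re, Complex.sub_im]
    ring
  have eb := two_mul_re_inner_nonlinearity hlam a b b 1 fun x => by
    simp only [Complex.sq_norm, Complex.normSq_apply, Complex.mul_re, Complex.conj_re,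
      Complex.conj_im, Complex.sub_re, Complex.sub_im]
    ring
  -- The rule is exact on the quadratic kinetic term, so the gradient of b - a never enters the
  -- error.
  have eg : (⟪(b - a).grad, a.grad⟫_ℂ).re + (⟪(b - a).grad, b.grad⟫_ℂ).re =
      ‖b.grad‖ ^ 2 - ‖a.grad‖ ^ 2 := by
    have h1 : (⟪a.grad, b.grad⟫_ℂ).re = (⟪b.grad, a.grad⟫_ℂ).re :=
      inner_re_symm (𝕜 := ℂ) a.grad b.grad
    have h2 : (⟪a.grad, a.grad⟫_ℂ).re = ‖a.grad‖ ^ 2 := inner_self_eq_norm_sq (𝕜 := ℂ) a.grad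
    have h3 : (⟪b.grad, b.grad⟫_ℂ).re = ‖b.grad‖ ^ 2 := inner_self_eq_norm_sq (𝕜 := ℂ) b.grad
    rw [sub_grad, inner_sub_left, inner_sub_left, Complex.sub_re, Complex.sub_re, h1, h2, h3]
    ring
  -- From ||b|² - |a|²| ≤ |b - a|(|b| + |a|), both bounds are linear in d.
  have hs : CoulombBounded (fun x => ‖b.fn x‖ ^ 2 - ‖a.fn x‖ ^ 2) (d * (2 * R))
      (4 * R * d) := by
    have h1 := ((b - a).coulombBounded_mul b).add ((b - a).coulombBounded_mul a)
    have h2 := h1.mono (f := fun x => ‖b.fn x‖ ^ 2 - ‖a.fn x‖ ^ 2)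
      (b.coulombBounded_density.integrable.aestronglyMeasurable.sub
        a.coulombBounded_density.integrable.aestronglyMeasurable) (by
      filter_upwards [Lp.coeFn_sub b.fn a.fn] with x hx
      rw [sub_fn, hx, Pi.sub_apply, sq_sub_sq, abs_mul, ← mul_add, mul_comm,
        abs_of_nonneg (by positivity : 0 ≤ ‖b.fn x‖ + ‖a.fn x‖)]
      exact mul_le_mul_of_nonneg_right (abs_norm_sub_norm_le _ _) (by positivity))
    refine ⟨h2.integrable, h2.integral_le.trans ?_, h2.kernel_integrable,
      fun x => (h2.pot_le x).trans ?_⟩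
    · rw [← mul_add]
      exact mul_le_mul_of_nonneg_left (by linarith [a.norm_fn_le, b.norm_fn_le]) hd0
    · rw [← hd, ← mul_add]
      nlinarith [a.norm_grad_le, b.norm_grad_le]
  have htri := a.coulombBounded_density.trapezoid_cubic b.coulombBounded_density hs fun _ => rfl
  have ta := a.coulombBounded_density.integral_mul_three_body hs lam
  have tb := b.coulombBounded_density.integral_mul_three_body hs lam
  simp only [← meanField_eq] at ta tb
  have hsss : |∫ x, (‖b.fn x‖ ^ 2 - ‖a.fn x‖ ^ 2) *
      coulombPot (fun x => ‖b.fn x‖ ^ 2 - ‖a.fn x‖ ^ 2) x *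
      coulombPot (fun x => ‖b.fn x‖ ^ 2 - ‖a.fn x‖ ^ 2) x| ≤ 64 * R ^ 4 * d ^ 2 := by
    have h1 := hs.abs_integral_mul_le
      (h := fun x => coulombPot (fun x => ‖b.fn x‖ ^ 2 - ‖a.fn x‖ ^ 2) x *
        coulombPot (fun x => ‖b.fn x‖ ^ 2 - ‖a.fn x‖ ^ 2) x)
      (K := (4 * R * d) ^ 2) fun x => by
        rw [abs_mul, ← sq]
        exact pow_le_pow_left₀ (abs_nonneg _) (hs.abs_coulombPot_le x) 2
    simp only [← mul_assoc] at h1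
    refine h1.trans ?_
    -- The bound obtained is 32R³d³; one factor d is traded for 2R.
    have h3 : 0 ≤ 32 * R ^ 3 * d ^ 2 := by positivity
    nlinarith [mul_le_mul_of_nonneg_left hd2 h3]
  have hda := (b - a).coulombBounded_density.abs_integral_mul_le
    (abs_meanField_le_of_norm_le hlam a ha)
  have hdb := (b - a).coulombBounded_density.abs_integral_mul_le
    (abs_meanField_le_of_norm_le hlam b hb)
  have hre : ∀ u : H1, (rhs hlam (b - a) u).re = (⟪(b - a).grad, u.grad⟫_ℂ).re +
      1 / 2 * (⟪(b - a).fn, u.nonlinearity hlam⟫_ℂ).re := fun u => by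
    have : (1 / 2 : ℂ) = ((1 / 2 : ℝ) : ℂ) := by norm_num
    rw [rhs, this, Complex.add_re, Complex.re_ofReal_mul]
  rw [ta] at ea
  rw [tb] at eb
  rw [Complex.add_re, hre, hre]
  -- The cubic remainder contributes 64/4 = 16 and each polarisation remainder 12/4 = 3, whence the
  -- constant 22.
  have hfin : energy lam b - energy lam a -
      ((⟪(b - a).grad, a.grad⟫_ℂ).re + 1 / 2 * (⟪(b - a).fn, a.nonlinearity hlam⟫_ℂ).re +
        ((⟪(b - a).grad, b.grad⟫_ℂ).re + 1 / 2 * (⟪(b - a).fn, b.nonlinearity hlam⟫_ℂ).re)) =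
      -(lam / 4 * ∫ x, (‖b.fn x‖ ^ 2 - ‖a.fn x‖ ^ 2) *
        coulombPot (fun x => ‖b.fn x‖ ^ 2 - ‖a.fn x‖ ^ 2) x *
        coulombPot (fun x => ‖b.fn x‖ ^ 2 - ‖a.fn x‖ ^ 2) x) +
      1 / 4 * (∫ x, ‖(b - a).fn x‖ ^ 2 * meanField lam a.fn x) -
      1 / 4 * ∫ x, ‖(b - a).fn x‖ ^ 2 * meanField lam b.fn x := by
    rw [energy, energy, cubic, cubic]
    linear_combination (-1 : ℝ) * eg - 1 / 4 * ea - 1 / 4 * eb + lam / 4 * htri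
  rw [hfin]
  rw [← hd] at hda hdb
  have h1 := abs_le.1 hda
  have h2 := abs_le.1 hdb
  have h3 := abs_le.1 hsss
  have h4 := mul_le_mul_of_nonneg_left h3.1 hlam
  have h5 := mul_le_mul_of_nonneg_left h3.2 hlam
  rw [abs_le]
  constructor <;> linarith [h1.1, h1.2, h2.1, h2.2]

end H1

namespace H1

/-- The trapezoidal estimate also makes the energy Lipschitz on H¹ balls: the two pairings are
linear in the increment, and one factor of the quadratic error is at most 2R. -/
lemma continuousOn_energy {lam : ℝ} (hlam : 0 ≤ lam) {φ : ℝ → H1} {s : Set ℝ} {R : ℝ}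
    (hφ : ContinuousOn φ s) (hR : ∀ t ∈ s, ‖φ t‖ ≤ R) :
    ContinuousOn (fun t => energy lam (φ t)) s := by
  intro t ht
  have hR0 : 0 ≤ R := (norm_nonneg _).trans (hR t ht)
  set K := 2 * (R + 6 * lam * R ^ 5) + 22 * lam * R ^ 4 * (2 * R) with hK
  have hest : ∀ r ∈ s, ‖energy lam (φ r) - energy lam (φ t)‖ ≤ K * ‖φ r - φ t‖ := by
    intro r hr
    have h1 := energy_trapezoid hlam (φ t) (φ r) (hR t ht) (hR r hr)
    have h2 := norm_rhs_le hlam (φ r - φ t) (φ t) (hR t ht)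
    have h3 := norm_rhs_le hlam (φ r - φ t) (φ r) (hR r hr)
    have h4 := (Complex.abs_re_le_norm _).trans
      (norm_add_le (rhs hlam (φ r - φ t) (φ t)) (rhs hlam (φ r - φ t) (φ r)))
    have h5 : ‖φ r - φ t‖ ≤ 2 * R := by
      linarith [norm_sub_le (φ r) (φ t), hR t ht, hR r hr]
    have h6 : ‖(φ r - φ t).fn‖ ^ 2 ≤ 2 * R * ‖φ r - φ t‖ := by
      have := (φ r - φ t).norm_fn_le
      calc ‖(φ r - φ t).fn‖ ^ 2 ≤ ‖φ r - φ t‖ ^ 2 := by gcongr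
        _ = ‖φ r - φ t‖ * ‖φ r - φ t‖ := sq _
        _ ≤ 2 * R * ‖φ r - φ t‖ := by gcongr
    have h7 := mul_le_mul_of_nonneg_left h6 (by positivity : 0 ≤ 22 * lam * R ^ 4)
    rw [Real.norm_eq_abs]
    rw [abs_le] at h1 h4 ⊢
    constructor <;> linarith [h1.1, h1.2, h4.1, h4.2]
  have h1 : Filter.Tendsto (fun r => K * ‖φ r - φ t‖) (nhdsWithin t s) (nhds 0) := by
    have : Filter.Tendsto (fun r => K * ‖φ r - φ t‖) (nhdsWithin t s)
        (nhds (K * ‖φ t - φ t‖)) := (((hφ t ht).sub_const _).norm).const_mul K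
    simpa using this
  refine tendsto_iff_norm_sub_tendsto_zero.2 (squeeze_zero' (Filter.Eventually.of_forall
    fun r => norm_nonneg _) ?_ h1)
  filter_upwards [self_mem_nhdsWithin] with r hr using hest r hr

end H1

/-! ### Mass and energy conservation for the Hartree equation. -/

namespace IsQuinticHartreeSolution

variable {lam : ℝ} {J : Set ℝ} {φ : ℝ → H1}

lemma hasDerivWithinAt_inner (hlam : 0 ≤ lam) (h : IsQuinticHartreeSolution lam J φ) (η : H1)
    {t : ℝ} (ht : t ∈ J) :
    HasDerivWithinAt (fun s => ⟪η.fn, (φ s).fn⟫_ℂ) (-Complex.I * H1.rhs hlam η (φ t)) J t := by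
  have h1 := (h.equation η t ht).const_mul (-Complex.I)
  simp only [← mul_assoc, neg_mul, Complex.I_mul_I, neg_neg, one_mul] at h1
  rw [H1.rhs, H1.inner_nonlinearity]
  simpa only [neg_mul, mul_assoc] using h1

/-- Conservation of mass and energy. -/
lemma conservation (hlam : 0 ≤ lam) (h : IsQuinticHartreeSolution lam J φ) {a b : ℝ}
    (hab : a < b) (hJ : Set.Icc a b ⊆ J) :
    ‖(φ a).fn‖ ^ 2 = ‖(φ b).fn‖ ^ 2 ∧ H1.energy lam (φ a) = H1.energy lam (φ b) := by
  have hφ : ContinuousOn φ (Set.Icc a b) := h.continuousOn.mono hJ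
  -- This R depends on the solution and the interval, which is harmless: the conclusions are exact
  -- identities.
  obtain ⟨R, hR⟩ := isCompact_Icc.exists_bound_of_continuousOn hφ
  have hR0 : 0 ≤ R := (norm_nonneg _).trans (hR a (Set.left_mem_Icc.2 hab.le))
  have hE := H1.continuousOn_energy hlam hφ hR
  have hp : ContinuousOn (fun t => (H1.rhs hlam (φ t) (φ t)).re) (Set.Icc a b) := by
    simp only [H1.rhs_self_re]
    exact (hE.const_mul 3 |>.congr fun _ _ => rfl).sub
      (((H1.continuous_grad.comp_continuousOn hφ).norm.pow 2).const_mul 2)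
  have hK : ∀ η, ∀ t ∈ Set.Icc a b,
      ‖H1.rhs hlam η (φ t)‖ ≤ (R + 6 * lam * R ^ 5) * ‖η‖ := fun η t ht =>
    H1.norm_rhs_le hlam η (φ t) (hR t ht)
  have heq : ∀ η, ∀ t ∈ Set.Icc a b, HasDerivWithinAt
      (fun s => ⟪H1.fnCLM η, H1.fnCLM (φ s)⟫_ℂ) (-Complex.I * H1.rhs hlam η (φ t))
      (Set.Icc a b) t := fun η t ht => (h.hasDerivWithinAt_inner hlam η (hJ ht)).mono hJ
  refine ⟨norm_eq_of_weak (ι := H1.fnCLM) hab hφ hK heq (H1.rhs_self_im hlam), ?_⟩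
  exact energy_eq_of_weak (ι := H1.fnCLM) (L := 22 * lam * R ^ 4) hab hφ hK heq
    (H1.rhs_sub hlam) hp hE (by positivity) (by positivity)
    fun s hs t ht => H1.energy_trapezoid hlam (φ s) (φ t) (hR s hs) (hR t ht)

lemma conservation_zero (hlam : 0 ≤ lam) (h : IsQuinticHartreeSolution lam J φ)
    (hJ : J.OrdConnected) (h0 : (0 : ℝ) ∈ J) {t : ℝ} (ht : t ∈ J) :
    ‖(φ t).fn‖ ^ 2 = ‖(φ 0).fn‖ ^ 2 ∧ H1.energy lam (φ t) = H1.energy lam (φ 0) := by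
  rcases lt_trichotomy t 0 with h1 | h1 | h1
  · exact h.conservation hlam h1 (hJ.out ht h0)
  · subst h1; exact ⟨rfl, rfl⟩
  · have := h.conservation hlam h1 (hJ.out h0 ht)
    exact ⟨this.1.symm, this.2.symm⟩

end IsQuinticHartreeSolution

/-! ### The squared three-body potential. -/

section ThreeBody

lemma measurable_coulomb_sub : Measurable fun p : R3 × R3 => ENNReal.ofReal (coulomb (p.1 - p.2) ^ 2) :=
  ((measurable_coulomb.comp (measurable_fst.sub measurable_snd)).pow_const 2).ennreal_ofReal

/-- This is (p + q + r)² ≤ 3(p² + q² + r²), with the Coulomb arguments oriented from parent to child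
in trees rooted at x, as `lintegral_kernel_pair_le` expects. -/
lemma threeBody_sq_le (lam : ℝ) (x y z : R3) :
    |threeBody lam (x - y) (x - z)| ^ 2 ≤ 3 * lam ^ 2 *
      (coulomb (x - y) ^ 2 * coulomb (x - z) ^ 2 + coulomb (x - y) ^ 2 * coulomb (y - z) ^ 2 +
        coulomb (x - z) ^ 2 * coulomb (z - y) ^ 2) := by
  have h1 : x - z - (x - y) = y - z := by abel
  have h2 : x - y - (x - z) = z - y := by abel
  rw [sq_abs]
  simp only [threeBody, coulomb_neg, h1, h2]
  rw [mul_pow, mul_comm (3 : ℝ), mul_assoc]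
  refine mul_le_mul_of_nonneg_left ?_ (sq_nonneg _)
  generalize coulomb (x - y) = p
  generalize coulomb (x - z) = q
  generalize coulomb (y - z) = r
  generalize coulomb (z - y) = s
  nlinarith [sq_nonneg (p * q - r * p), sq_nonneg (p * q - q * s), sq_nonneg (r * p - q * s)]

/-- Integrating a leaf against its parent costs a factor G uniformly in the parent, so each tree
contributes G². In the third tree y is the leaf, hence the swap of integrals. -/
lemma lintegral_kernel_pair_le {k : R3 → R3 → ℝ≥0∞} {r : R3 → ℝ≥0∞} {G : ℝ≥0∞}
    (hkm : Measurable fun p : R3 × R3 => k p.1 p.2) (hrm : Measurable r)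
    (hH : ∀ x, ∫⁻ y, k x y * r y ≤ G) (x : R3) :
    ∫⁻ y, ∫⁻ z, (k x y * r y * (k x z * r z) + k x y * r y * (k y z * r z) +
      k x z * r z * (k z y * r y)) ≤ 3 * G ^ 2 := by
  have hkl : ∀ x, Measurable (k x) := fun x => hkm.comp (measurable_const.prodMk measurable_id)
  have hkr : ∀ x, Measurable fun y => k x y * r y := fun x => (hkl x).mul hrm
  have m1 : Measurable fun p : R3 × R3 => k x p.1 * r p.1 * (k x p.2 * r p.2) :=
    (((hkl x).comp measurable_fst).mul (hrm.comp measurable_fst)).mul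
      (((hkl x).comp measurable_snd).mul (hrm.comp measurable_snd))
  have m2 : Measurable fun p : R3 × R3 => k x p.1 * r p.1 * (k p.1 p.2 * r p.2) :=
    (((hkl x).comp measurable_fst).mul (hrm.comp measurable_fst)).mul
      (hkm.mul (hrm.comp measurable_snd))
  have m3 : Measurable fun p : R3 × R3 => k x p.2 * r p.2 * (k p.2 p.1 * r p.1) :=
    m2.comp measurable_swap
  have b2 : ∫⁻ y, ∫⁻ z, k x y * r y * (k y z * r z) ≤ G ^ 2 := by
    calc ∫⁻ y, ∫⁻ z, k x y * r y * (k y z * r z)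
        ≤ ∫⁻ y, k x y * r y * G := by
          refine lintegral_mono fun y => ?_
          rw [lintegral_const_mul _ (hkr y)]
          exact mul_le_mul_right (hH y) _
      _ = (∫⁻ y, k x y * r y) * G := lintegral_mul_const _ (hkr x)
      _ ≤ G ^ 2 := by rw [sq]; exact mul_le_mul_left (hH x) _
  have b1 : ∫⁻ y, ∫⁻ z, k x y * r y * (k x z * r z) ≤ G ^ 2 := by
    calc ∫⁻ y, ∫⁻ z, k x y * r y * (k x z * r z)
        ≤ ∫⁻ y, k x y * r y * G := by
          refine lintegral_mono fun y => ?_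
          rw [lintegral_const_mul _ (hkr x)]
          exact mul_le_mul_right (hH x) _
      _ = (∫⁻ y, k x y * r y) * G := lintegral_mul_const _ (hkr x)
      _ ≤ G ^ 2 := by rw [sq]; exact mul_le_mul_left (hH x) _
  have b3 : ∫⁻ y, ∫⁻ z, k x z * r z * (k z y * r y) ≤ G ^ 2 := by
    rw [lintegral_lintegral_swap (f := fun y z => k x z * r z * (k z y * r y)) m3.aemeasurable]
    exact b2
  have hsum : ∫⁻ y, ∫⁻ z, (k x y * r y * (k x z * r z) + k x y * r y * (k y z * r z) +
      k x z * r z * (k z y * r y)) =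
      (∫⁻ y, ∫⁻ z, k x y * r y * (k x z * r z)) + (∫⁻ y, ∫⁻ z, k x y * r y * (k y z * r z)) +
      ∫⁻ y, ∫⁻ z, k x z * r z * (k z y * r y) := by
    have l1 : Measurable fun y => ∫⁻ z, k x y * r y * (k x z * r z) := m1.lintegral_prod_right'
    have l2 : Measurable fun y => ∫⁻ z, k x y * r y * (k y z * r z) := m2.lintegral_prod_right'
    have l12 : Measurable fun y => (∫⁻ z, k x y * r y * (k x z * r z)) +
      ∫⁻ z, k x y * r y * (k y z * r z) := l1.add l2
    rw [← lintegral_add_left l1, ← lintegral_add_left l12]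
    refine lintegral_congr fun y => ?_
    have s1 : Measurable fun z => k x y * r y * (k x z * r z) := (hkr x).const_mul _
    have s12 : Measurable fun z => k x y * r y * (k x z * r z) + k x y * r y * (k y z * r z) :=
      s1.add ((hkr y).const_mul _)
    rw [lintegral_add_left s12, lintegral_add_left s1]
  rw [hsum]
  refine (add_le_add (add_le_add b1 b2) b3).trans_eq ?_
  ring

/-- The square of the three-body potential integrated against a wave function. -/
lemma lintegral_threeBody_sq_le (lam : ℝ) (u : H1) :
    ∫⁻ x : R3, ∫⁻ y : R3, ∫⁻ z : R3,
      ENNReal.ofReal (|threeBody lam (x - y) (x - z)| ^ 2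
        * ‖u.fn x‖ ^ 2 * ‖u.fn y‖ ^ 2 * ‖u.fn z‖ ^ 2) ≤
      ENNReal.ofReal (9 * lam ^ 2 * ‖u.fn‖ ^ 2 * (4 * ‖u.grad‖ ^ 2) ^ 2) := by
  set k : R3 → R3 → ℝ≥0∞ := fun x y => ENNReal.ofReal (coulomb (x - y) ^ 2) with hk
  set r : R3 → ℝ≥0∞ := fun x => ENNReal.ofReal (‖u.fn x‖ ^ 2) with hr
  set G := ENNReal.ofReal (4 * ‖u.grad‖ ^ 2) with hG
  set L := ENNReal.ofReal (3 * lam ^ 2) with hL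
  have hum : Measurable fun x => u.fn x := (Lp.stronglyMeasurable u.fn).measurable
  have hrm : Measurable r := (hum.norm.pow_const 2).ennreal_ofReal
  have hkm : Measurable fun p : R3 × R3 => k p.1 p.2 := measurable_coulomb_sub
  have hH : ∀ x, ∫⁻ y, k x y * r y ≤ G := fun x => by
    refine le_trans (le_of_eq ?_) (hardy u x)
    refine lintegral_congr fun y => ?_
    rw [ENNReal.ofReal_mul (sq_nonneg _)]
  have hmass : ∫⁻ x, r x = ENNReal.ofReal (‖u.fn‖ ^ 2) := by
    rw [norm_toLp_sq_eq_integral, ofReal_integral_eq_lintegral_ofReal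
      ((memLp_two_iff_integrable_sq_norm (Lp.aestronglyMeasurable u.fn)).1 (Lp.memLp u.fn))
      (Filter.Eventually.of_forall fun _ => sq_nonneg _)]
  have hpt : ∀ x y z, ENNReal.ofReal (|threeBody lam (x - y) (x - z)| ^ 2
        * ‖u.fn x‖ ^ 2 * ‖u.fn y‖ ^ 2 * ‖u.fn z‖ ^ 2) ≤
      L * r x * (k x y * r y * (k x z * r z) + k x y * r y * (k y z * r z) +
        k x z * r z * (k z y * r y)) := by
    intro x y z
    simp only [hk, hr, hL]
    repeat rw [← ENNReal.ofReal_mul (by positivity)]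
    repeat rw [← ENNReal.ofReal_add (by positivity) (by positivity)]
    rw [← ENNReal.ofReal_mul (by positivity)]
    refine ENNReal.ofReal_le_ofReal ?_
    have h1 := threeBody_sq_le lam x y z
    have h2 : 0 ≤ ‖u.fn x‖ ^ 2 * ‖u.fn y‖ ^ 2 * ‖u.fn z‖ ^ 2 := by positivity
    refine le_trans (le_of_eq ?_) ((mul_le_mul_of_nonneg_right h1 h2).trans_eq ?_) <;> ring
  have hx : ∀ x, ∫⁻ y, ∫⁻ z, (k x y * r y * (k x z * r z) + k x y * r y * (k y z * r z) +
        k x z * r z * (k z y * r y)) ≤ 3 * G ^ 2 := lintegral_kernel_pair_le hkm hrm hH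
  have htop : L * (∫⁻ x, r x) * (3 * G ^ 2) =
      ENNReal.ofReal (9 * lam ^ 2 * ‖u.fn‖ ^ 2 * (4 * ‖u.grad‖ ^ 2) ^ 2) := by
    rw [hmass, hL, hG, ← ENNReal.ofReal_pow (by positivity)]
    have : (3 : ℝ≥0∞) = ENNReal.ofReal 3 := by norm_num
    rw [this]
    repeat rw [← ENNReal.ofReal_mul (by positivity)]
    congr 1
    ring
  rw [← htop, ← lintegral_const_mul L hrm, ← lintegral_mul_const _ (hrm.const_mul L)]
  refine lintegral_mono fun x => ?_
  refine le_trans (lintegral_mono fun y => lintegral_mono fun z => hpt x y z) ?_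
  have hLr : L * r x ≠ ∞ := ENNReal.mul_ne_top ENNReal.ofReal_ne_top ENNReal.ofReal_ne_top
  simp only [lintegral_const_mul' _ _ hLr]
  exact mul_le_mul_right (hx x) _

end ThreeBody

theorem mainTheorem9 (lam : ℝ) (hlam : 0 < lam) (M : ℝ) :
    ∃ C : ℝ≥0, ∀ (J : Set ℝ) (φ : ℝ → H1),
      J.OrdConnected → (0 : ℝ) ∈ J → IsQuinticHartreeSolution lam J φ → ‖φ 0‖ ≤ M →
      ∀ t ∈ J,
        ∫⁻ x : R3, ∫⁻ y : R3, ∫⁻ z : R3,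
          ENNReal.ofReal (|threeBody lam (x - y) (x - z)| ^ 2
            * ‖(φ t).fn x‖ ^ 2 * ‖(φ t).fn y‖ ^ 2 * ‖(φ t).fn z‖ ^ 2) ≤ C := by
  -- Here M² bounds the mass, and M² + 2·lam·M⁶ bounds the initial energy, hence the squared
  -- gradient norm at every time.
  refine ⟨(9 * lam ^ 2 * M ^ 2 * (4 * (M ^ 2 + 2 * lam * M ^ 6)) ^ 2).toNNReal,
    fun J φ hJ h0 hφ hM t ht => (lintegral_threeBody_sq_le lam (φ t)).trans ?_⟩
  have hM0 : 0 ≤ M := (norm_nonneg _).trans hM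
  obtain ⟨hmass, henergy⟩ := hφ.conservation_zero hlam.le hJ h0 ht
  have hf0 : ‖(φ 0).fn‖ ≤ M := (φ 0).norm_fn_le.trans hM
  have hg0 : ‖(φ 0).grad‖ ≤ M := (φ 0).norm_grad_le.trans hM
  have hc0 : (φ 0).cubic ≤ 4 * M ^ 6 := by
    calc (φ 0).cubic ≤ (2 * ‖(φ 0).fn‖ * ‖(φ 0).grad‖) ^ 2 * ‖(φ 0).fn‖ ^ 2 := (φ 0).cubic_le
      _ ≤ (2 * M * M) ^ 2 * M ^ 2 := by gcongr
      _ = 4 * M ^ 6 := by ring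
  have hgrad : ‖(φ t).grad‖ ^ 2 ≤ M ^ 2 + 2 * lam * M ^ 6 := by
    have h1 : ‖(φ t).grad‖ ^ 2 ≤ H1.energy lam (φ t) := by
      have := (φ t).cubic_nonneg
      rw [H1.energy]
      nlinarith
    have h2 : H1.energy lam (φ 0) ≤ M ^ 2 + lam / 2 * (4 * M ^ 6) := by
      rw [H1.energy]
      gcongr
    linarith
  refine ENNReal.ofReal_le_ofReal ?_
  rw [hmass]
  gcongr
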